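/- Let $G$ be a connected complex Lie group with simple Lie algebra $\mathfrak g$, and let $\rho_0,\tau_0$ be commuting antiholomorphic involutive automorphisms of $G$ such that $\rho_0$ is a compact real form (the Killing form is negative definite on $\mathfrak g^{\rho_0}$) and $\tau_0$ is a split real form (there is a $\tau_0$-stable Cartan subalgebra $\mathfrak h\subset\mathfrak g$ such that $\mathrm{ad}_x$ has real eigenvalues for all $x\in\mathfrak h^{\tau_0}$). Put $\sigma_0=\rho_0\tau_0$. An element $x\in\mathfrak g$ is *principal nilpotent* if $\mathrm{ad}_x$ is nilpotent and its centralizer has dimension $\mathrm{rk}\,\mathfrak g$. Let $S$ be a closed smooth surface (for example a closed orientable surface of genus at least $2$). A *$G$-Fock bundle* over $S$ is a triple $(P,\Phi,\sigma)$ where $P\to S$ is a smooth principal $G$-bundle with adjoint bundle $\mathfrak g_P=P\times_G\mathfrak g$; $\sigma$ is a $\sigma_0$-structure, i.e. a smooth involution of $P$ covering $\mathrm{id}_S$ with $\sigma(p\cdot g)=\sigma(p)\cdot\sigma_0(g)$ whose fixed point locus is a reduction of the structure group of $P$ to $G^{\sigma_0}$ (i.e. meets every fibre); and $\Phi\in\Omega^1(S,\mathfrak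 g_P)$ is a smooth $1$-form such that 1. $[\Phi\wedge\Phi]=0$, 2. $\Phi(v)$ is principal nilpotent for every $x\in S$ and every non-zero $v\in T_xS$, 3. $\sigma(\Phi)=-\Phi$, where $\sigma$ acts on $\mathfrak g_P$ by $[p,X]\mapsto[\sigma(p),\sigma_0(X)]$. An *infinitesimal automorphism* of $(P,\Phi,\sigma)$ is an infinitesimal gauge transformation $\eta\in\Omega^0(S,\mathfrak g_P)$ that preserves $\Phi$ and $\sigma$ to first order: $[\Phi,\eta]=0$ and $\sigma(\eta)=\eta$. The *$\Phi$-cohomology* $\mathrm H^\bullet(\Phi)$ is the cohomology of the complex $$\Omega^0(S,\mathfrak g_P)\xrightarrow{\ \mathrm{ad}_\Phi\ }\Omega^1(S,\mathfrak g_P)\xrightarrow{\ \mathrm{ad}_\Phi\ }\Omega^2(S,\mathfrak g_P),\qquad \mathrm{ad}_\Phi(\omega)=[\Phi\wedge\omega],$$ on which $\sigma$ acts, and $\mathrm H^{k,\sigma}(\Phi)\subset\mathrm H^k(\Phi)$ is the subspace of classes represented by $\sigma$-invariant cocycles; equivalently, it is the subspace of $\sigma$-fixed classes. **Proposition.** Let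 $(P,\Phi,\sigma)$ be a $G$-Fock bundle over $S$. Then it has no non-zero infinitesimal automorphism. Moreover $\mathrm H^{k,\sigma}(\Phi)=0$ for $k=0,1,2$, and $\sigma$ acts by $-1$ on $\mathrm H^k(\Phi)$ for every $k$. -/

import Mathlib

open scoped Manifold ContDiff

noncomputable section

namespace Fock

/-! ### Complex Lie groups as real Lie groups -/

section LieGroup

open VectorField Set

variable {E : Type*} [NormedAddCommGroup E] [NormedSpace ℂ E]
  {M : Type*} [TopologicalSpace M] [ChartedSpace E M]
  {M' : Type*} [TopologicalSpace M'] [ChartedSpace E M']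

theorem hasMFDerivAt_real {f : M → M'} {x : M} {f' : E →L[ℂ] E}
    (h : HasMFDerivAt 𝓘(ℂ, E) 𝓘(ℂ, E) f x f') :
    HasMFDerivAt 𝓘(ℝ, E) 𝓘(ℝ, E) f x (f'.restrictScalars ℝ) :=
  ⟨h.1, HasFDerivWithinAt.restrictScalars ℝ h.2⟩

theorem contMDiff_real {f : M → M'} {n : ℕ∞ω} (h : ContMDiff 𝓘(ℂ, E) 𝓘(ℂ, E) n f) :
    ContMDiff 𝓘(ℝ, E) 𝓘(ℝ, E) n f := by
  intro x
  have hx := h x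
  rw [contMDiffAt_iff] at hx ⊢
  exact ⟨hx.1, ContDiffWithinAt.restrict_scalars ℝ hx.2⟩

theorem mfderiv_real {f : M → M'} {x : M} (h : MDifferentiableAt 𝓘(ℂ, E) 𝓘(ℂ, E) f x) :
    (mfderiv 𝓘(ℝ, E) 𝓘(ℝ, E) f x : E →L[ℝ] E) =
      (mfderiv 𝓘(ℂ, E) 𝓘(ℂ, E) f x : E →L[ℂ] E).restrictScalars ℝ :=
  (hasMFDerivAt_real h.hasMFDerivAt).mfderiv

theorem isManifold_real {n : ℕ∞ω} [IsManifold 𝓘(ℂ, E) n M] : IsManifold 𝓘(ℝ, E) n M := by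
  apply isManifold_of_contDiffOn
  intro e e' he he'
  have := (contDiffGroupoid n 𝓘(ℂ, E)).compatible he he'
  have h2 := (mem_groupoid_of_pregroupoid.1 this).1
  exact ContDiffOn.restrict_scalars ℝ h2

theorem inverse_restrictScalars (f : E →L[ℂ] E) (hf : f.IsInvertible) :
    (f.restrictScalars ℝ).inverse = (f.inverse).restrictScalars ℝ := by
  obtain ⟨e, rfl⟩ := hf
  have : ((e : E →L[ℂ] E).restrictScalars ℝ) = (e.restrictScalars ℝ : E ≃L[ℝ] E) := rfl
  rw [this, ContinuousLinearMap.inverse_equiv, ContinuousLinearMap.inverse_equiv]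
  rfl

theorem lieBracketWithin_real {V W V' W' : E → E} {a : E} (hV : DifferentiableAt ℂ V a)
    (hW : DifferentiableAt ℂ W a) (h : V' =ᶠ[nhds a] V) (h' : W' =ᶠ[nhds a] W) :
    lieBracketWithin ℝ V' W' univ a = lieBracketWithin ℂ V W univ a := by
  have e1 : fderiv ℝ V' a = (fderiv ℂ V a).restrictScalars ℝ :=
    ((hV.hasFDerivAt.restrictScalars ℝ).congr_of_eventuallyEq h).fderiv
  have e2 : fderiv ℝ W' a = (fderiv ℂ W a).restrictScalars ℝ :=
    ((hW.hasFDerivAt.restrictScalars ℝ).congr_of_eventuallyEq h').fderiv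
  simp only [lieBracketWithin, fderivWithin_univ, e1, e2, h.eq_of_nhds, h'.eq_of_nhds]
  rfl

theorem mlieBracket_real [CompleteSpace E] [IsManifold 𝓘(ℂ, E) 2 M]
    {V W : Π x : M, TangentSpace 𝓘(ℂ, E) x} {x : M}
    (hV : MDifferentiableAt 𝓘(ℂ, E) 𝓘(ℂ, E).tangent (fun y => (V y : TangentBundle 𝓘(ℂ, E) M)) x)
    (hW : MDifferentiableAt 𝓘(ℂ, E) 𝓘(ℂ, E).tangent (fun y => (W y : TangentBundle 𝓘(ℂ, E) M)) x) :
    (mlieBracket 𝓘(ℝ, E) (M := M) V W x : E) = (mlieBracket 𝓘(ℂ, E) V W x : E) := by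
  have hI : IsManifold 𝓘(ℂ, E) 1 M := IsManifold.of_le (n := 2) one_le_two
  -- pulled back fields agree near the point
  have key : ∀ U : Π x : M, TangentSpace 𝓘(ℂ, E) x, ∀ y ∈ (extChartAt 𝓘(ℂ, E) x).target,
      (mpullbackWithin 𝓘(ℝ, E) 𝓘(ℝ, E) (extChartAt 𝓘(ℝ, E) x).symm (fun z => (U z : E))
          (range 𝓘(ℝ, E)) y : E) =
        mpullbackWithin 𝓘(ℂ, E) 𝓘(ℂ, E) (extChartAt 𝓘(ℂ, E) x).symm U (range 𝓘(ℂ, E)) y := by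
    intro U y hy
    have hinv := isInvertible_mfderivWithin_extChartAt_symm (I := 𝓘(ℂ, E)) hy
    have hd := mdifferentiableWithinAt_of_isInvertible_mfderivWithin hinv
    simp only [mpullbackWithin]
    have e1 : (range 𝓘(ℂ, E)) = (univ : Set E) := by simp
    have e2 : (range 𝓘(ℝ, E)) = (univ : Set E) := by simp
    rw [e1] at hinv hd
    rw [e1, e2, mfderivWithin_univ, mfderivWithin_univ]
    rw [mfderivWithin_univ] at hinv
    rw [mdifferentiableWithinAt_univ] at hd
    have h1 := mfderiv_real (M := E) (M' := M) hd
    have h3 : (mfderiv 𝓘(ℝ, E) 𝓘(ℝ, E) (extChartAt 𝓘(ℂ, E) x).symm y : E →L[ℝ] E).inverse =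
        ((mfderiv 𝓘(ℂ, E) 𝓘(ℂ, E) (extChartAt 𝓘(ℂ, E) x).symm y :
          E →L[ℂ] E).inverse).restrictScalars ℝ := by rw [h1]; exact inverse_restrictScalars (E := E) _ hinv
    exact congrArg (fun L : E →L[ℝ] E => L (U ((extChartAt 𝓘(ℂ, E) x).symm y))) h3
  have hmem : (extChartAt 𝓘(ℂ, E) x).target ∈ nhds (extChartAt 𝓘(ℂ, E) x x) :=
    extChartAt_target_mem_nhds x
  have dV := MDifferentiableWithinAt.differentiableWithinAt_mpullbackWithin_vectorField
    (mdifferentiableWithinAt_univ.2 hV)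
  have dW := MDifferentiableWithinAt.differentiableWithinAt_mpullbackWithin_vectorField
    (mdifferentiableWithinAt_univ.2 hW)
  have hset : ((extChartAt 𝓘(ℂ, E) x).symm ⁻¹' univ ∩ range 𝓘(ℂ, E)) = (univ : Set E) := by simp
  have hset' : ((extChartAt 𝓘(ℝ, E) x).symm ⁻¹' univ ∩ range 𝓘(ℝ, E)) = (univ : Set E) := by simp
  rw [hset] at dV dW
  have hb : lieBracketWithin ℝ
      (fun y => (mpullbackWithin 𝓘(ℝ, E) 𝓘(ℝ, E) (extChartAt 𝓘(ℝ, E) x).symm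
        (fun z => (V z : E)) (range 𝓘(ℝ, E)) y : E))
      (fun y => (mpullbackWithin 𝓘(ℝ, E) 𝓘(ℝ, E) (extChartAt 𝓘(ℝ, E) x).symm
        (fun z => (W z : E)) (range 𝓘(ℝ, E)) y : E)) univ (extChartAt 𝓘(ℂ, E) x x) =
      lieBracketWithin ℂ
      (fun y => (mpullbackWithin 𝓘(ℂ, E) 𝓘(ℂ, E) (extChartAt 𝓘(ℂ, E) x).symm V
        (range 𝓘(ℂ, E)) y : E))
      (fun y => (mpullbackWithin 𝓘(ℂ, E) 𝓘(ℂ, E) (extChartAt 𝓘(ℂ, E) x).symm W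
        (range 𝓘(ℂ, E)) y : E)) univ (extChartAt 𝓘(ℂ, E) x x) := by
    apply lieBracketWithin_real
    · exact differentiableWithinAt_univ.1 dV
    · exact differentiableWithinAt_univ.1 dW
    · filter_upwards [hmem] with y hy using key V y hy
    · filter_upwards [hmem] with y hy using key W y hy
  have hinv := isInvertible_mfderiv_extChartAt (I := 𝓘(ℂ, E)) (mem_extChartAt_source (I := 𝓘(ℂ, E)) x)
  have hd := mdifferentiableAt_of_isInvertible_mfderiv hinv
  have h1 := mfderiv_real (M := M) (M' := E) hd
  have h3 : (mfderiv 𝓘(ℝ, E) 𝓘(ℝ, E) (extChartAt 𝓘(ℂ, E) x) x : E →L[ℝ] E).inverse =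
      ((mfderiv 𝓘(ℂ, E) 𝓘(ℂ, E) (extChartAt 𝓘(ℂ, E) x) x :
        E →L[ℂ] E).inverse).restrictScalars ℝ := by
    rw [h1]; exact inverse_restrictScalars (E := E) _ hinv
  have hb' := hb
  rw [← hset] at hb'
  refine Eq.trans (congrArg (fun L : E →L[ℝ] E => L _) h3) ?_
  exact congrArg (fun u : E => (mfderiv 𝓘(ℂ, E) 𝓘(ℂ, E) (extChartAt 𝓘(ℂ, E) x) x :
        E →L[ℂ] E).inverse u) hb'

variable {G : Type*} [TopologicalSpace G] [ChartedSpace E G] [Group G]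

theorem lieGroup_real [LieGroup 𝓘(ℂ, E) ω G] : LieGroup 𝓘(ℝ, E) ω G := by
  have : IsManifold 𝓘(ℝ, E) ω G := isManifold_real
  refine { contMDiff_mul := ?_, contMDiff_inv := contMDiff_real (contMDiff_inv 𝓘(ℂ, E) ω) }
  intro x
  have hx := contMDiff_mul 𝓘(ℂ, E) ω (G := G) x
  rw [contMDiffAt_iff] at hx ⊢
  exact ⟨hx.1, ContDiffWithinAt.restrict_scalars ℝ hx.2⟩

theorem bracket_real [CompleteSpace E] [LieGroup 𝓘(ℂ, E) ω G] (v w : E) :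
    (Bracket.bracket (L := GroupLieAlgebra 𝓘(ℝ, E) G) (M := GroupLieAlgebra 𝓘(ℝ, E) G) v w : E) =
      (Bracket.bracket (L := GroupLieAlgebra 𝓘(ℂ, E) G) (M := GroupLieAlgebra 𝓘(ℂ, E) G) v w : E) := by
  have h : ∀ v : E, (fun g => (mulInvariantVectorField (I := 𝓘(ℝ, E)) (G := G) v g : E)) =
      fun g => (mulInvariantVectorField (I := 𝓘(ℂ, E)) (G := G) v g : E) := by
    intro v
    funext g
    have := mfderiv_real (E := E) (f := fun h : G => g * h) (x := 1)
      ((contMDiff_mul_left (I := 𝓘(ℂ, E)) (n := ω)).mdifferentiableAt (by simp))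
    exact congrArg (fun L : E →L[ℝ] E => L v) this
  have := mlieBracket_real (E := E) (M := G) (x := 1)
    (mdifferentiableAt_mulInvariantVectorField (I := 𝓘(ℂ, E)) (G := G) v)
    (mdifferentiableAt_mulInvariantVectorField (I := 𝓘(ℂ, E)) (G := G) w)
  refine Eq.trans ?_ this
  have hv := h v
  have hw := h w
  exact congrArg₂ (fun V W : G → E => (mlieBracket 𝓘(ℝ, E) (M := G) V W 1 : E)) hv hw

variable (E G) in
/-- The Lie algebra `𝔤` of the complex Lie group `G`. -/
abbrev LieAlg : Type _ := GroupLieAlgebra 𝓘(ℂ, E) G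

/-- The real derivative at `g` of a map `f : G → G`, in terms of the identification of all tangent
spaces of `G` with the model space `E`. -/
def realDeriv (f : G → G) (g : G) : E →L[ℝ] E := mfderiv 𝓘(ℝ, E) 𝓘(ℝ, E) f g

variable (E) in
/-- The differential at the identity of a (real-)smooth automorphism of `G`, as a real-linear
endomorphism of `𝔤`. -/
def differential (f : G ≃* G) : LieAlg E G →ₗ[ℝ] LieAlg E G :=
  (realDeriv (E := E) f (1 : G)).toLinearMap

theorem mfderiv_mulEquiv_comp (f h : G ≃* G) (hf : ContMDiff 𝓘(ℝ, E) 𝓘(ℝ, E) ∞ f)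
    (hh : ContMDiff 𝓘(ℝ, E) 𝓘(ℝ, E) ∞ h) (e : ∀ x, f (h x) = x) (g : G) :
    (mfderiv 𝓘(ℝ, E) 𝓘(ℝ, E) f (h g) : E →L[ℝ] E).comp
        (mfderiv 𝓘(ℝ, E) 𝓘(ℝ, E) h g : E →L[ℝ] E) = ContinuousLinearMap.id ℝ E := by
  have := mfderiv_comp (I' := 𝓘(ℝ, E)) g ((hf (h g)).mdifferentiableAt (by simp))
    ((hh g).mdifferentiableAt (by simp))
  refine this.symm.trans ?_
  have e : (f ∘ h : G → G) = id := by ext; simp [e]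
  rw [e]; exact mfderiv_id

theorem differential_lie [CompleteSpace E] [LieGroup 𝓘(ℂ, E) ω G] (f : G ≃* G)
    (hf : ContMDiff 𝓘(ℝ, E) 𝓘(ℝ, E) ∞ f) (hf' : ContMDiff 𝓘(ℝ, E) 𝓘(ℝ, E) ∞ f.symm)
    (v w : LieAlg E G) :
    differential E f ⁅v, w⁆ = ⁅differential E f v, differential E f w⁆ := by
  have : LieGroup 𝓘(ℝ, E) ω G := lieGroup_real
  let D : G → E →L[ℝ] E := fun g => mfderiv 𝓘(ℝ, E) 𝓘(ℝ, E) f g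
  let D' : G → E →L[ℝ] E := fun g => mfderiv 𝓘(ℝ, E) 𝓘(ℝ, E) f.symm (f g)
  let X : E → G → E := fun u g =>
    mulInvariantVectorField (I := 𝓘(ℝ, E)) (G := G) (u : GroupLieAlgebra 𝓘(ℝ, E) G) g
  have h1 : ∀ g, (D' g).comp (D g) = ContinuousLinearMap.id ℝ E := fun g =>
    mfderiv_mulEquiv_comp f.symm f hf' hf f.symm_apply_apply g
  have h2 : ∀ g, (D g).comp (D' g) = ContinuousLinearMap.id ℝ E := fun g => by
    have := mfderiv_mulEquiv_comp f f.symm hf hf' f.apply_symm_apply (f g)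
    rw [f.symm_apply_apply] at this
    exact this
  have hinv : ∀ g, (D g).inverse = D' g := fun g => ContinuousLinearMap.inverse_eq (h2 g) (h1 g)
  -- `f` intertwines left translations, hence relates invariant fields
  have hrel : ∀ (u : E) g, X (D 1 u) (f g) = D g (X u g) := by
    intro u g
    have hL : ∀ g h : G, MDifferentiableAt 𝓘(ℝ, E) 𝓘(ℝ, E) (fun x => g * x) h := fun g h =>
      (contMDiff_mul_left (I := 𝓘(ℝ, E)) (n := ω)).mdifferentiableAt (by simp)
    have c1 := mfderiv_comp (I' := 𝓘(ℝ, E)) (1 : G)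
      ((hf (g * 1)).mdifferentiableAt (by simp)) (hL g 1)
    have c2 := mfderiv_comp (I' := 𝓘(ℝ, E)) (1 : G) (hL (f g) (f 1))
      ((hf 1).mdifferentiableAt (by simp))
    have e : (f ∘ (fun x => g * x) : G → G) = (fun x => f g * x) ∘ f := by ext; simp
    rw [e, c2] at c1
    have c3 := congrArg (fun L : E →L[ℝ] E => L u) c1
    have c4 : (mfderiv 𝓘(ℝ, E) 𝓘(ℝ, E) (fun x => f g * x) (f 1) : E →L[ℝ] E) (D 1 u) =
      D (g * 1) (X u g) := c3
    rw [map_one] at c4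
    exact c4.trans (congrArg (fun h => D h (X u g)) (mul_one g))
  have hpull : ∀ u : E, (fun g => (D g).inverse (X (D 1 u) (f g))) = X u := by
    intro u
    funext g
    rw [hinv, hrel]
    exact congrArg (fun L : E →L[ℝ] E => L (X u g)) (h1 g)
  have hn : minSmoothness ℝ 2 ≤ (∞ : ℕ∞ω) := by
    simp only [minSmoothness_of_isRCLikeNormedField]
    exact ENat.LEInfty.out
  have main := mpullback_mlieBracket (I := 𝓘(ℝ, E)) (I' := 𝓘(ℝ, E)) (f := f) (x₀ := (1 : G))
    (mdifferentiableAt_mulInvariantVectorField (I := 𝓘(ℝ, E)) (G := G) (D 1 v))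
    (mdifferentiableAt_mulInvariantVectorField (I := 𝓘(ℝ, E)) (G := G) (D 1 w))
    (hf 1) hn
  let B : (G → E) → (G → E) → G → E := fun V W g => mlieBracket 𝓘(ℝ, E) (M := G) V W g
  have main' : (D 1).inverse (B (X (D 1 v)) (X (D 1 w)) (f 1)) = B (X v) (X w) 1 := by
    rw [← hpull v, ← hpull w]
    exact main
  have b1 : B (X v) (X w) 1 = ⁅v, w⁆ := bracket_real (E := E) (G := G) v w
  have b2 : B (X (D 1 v)) (X (D 1 w)) 1 = ⁅differential E f v, differential E f w⁆ :=
    bracket_real (E := E) (G := G) (D 1 v) (D 1 w)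
  rw [map_one, b1, hinv, b2] at main'
  have h3 := congrArg (D 1) main'
  refine Eq.trans h3.symm ?_
  exact congrArg (fun L : E →L[ℝ] E => L (⁅differential E f v, differential E f w⁆ : LieAlg E G)) (h2 1)

/-- The adjoint action of `G` on `𝔤`: the differential at the identity of conjugation. -/
def Ad (g : G) : LieAlg E G →ₗ[ℝ] LieAlg E G := differential E (MulAut.conj g)

theorem contMDiff_conj [LieGroup 𝓘(ℂ, E) ω G] (g : G) :
    ContMDiff 𝓘(ℂ, E) 𝓘(ℂ, E) ω (MulAut.conj g : G ≃* G) := by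
  have : ContMDiff 𝓘(ℂ, E) 𝓘(ℂ, E) ω (fun x : G => g * x * g⁻¹) :=
    (contMDiff_mul_right (I := 𝓘(ℂ, E)) (a := g⁻¹)).comp
      (contMDiff_mul_left (I := 𝓘(ℂ, E)) (a := g))
  exact this

theorem Ad_lie [CompleteSpace E] [LieGroup 𝓘(ℂ, E) ω G] (g : G) (v w : LieAlg E G) :
    Ad g ⁅v, w⁆ = ⁅Ad g v, Ad g w⁆ := by
  refine differential_lie _ ((contMDiff_real (contMDiff_conj g)).of_le le_top) ?_ v w
  have : (MulAut.conj g).symm = (MulAut.conj g⁻¹ : G ≃* G) := by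
    ext; simp [MulAut.conj_symm_apply]
  rw [this]
  exact (contMDiff_real (contMDiff_conj g⁻¹)).of_le le_top

theorem Ad_smul [LieGroup 𝓘(ℂ, E) ω G] (g : G) (c : ℂ) (v : LieAlg E G) :
    Ad g (c • v) = c • Ad g v := by
  have h := mfderiv_real (E := E) (f := (MulAut.conj g : G ≃* G)) (x := 1)
    ((contMDiff_conj g).mdifferentiableAt (by simp))
  let L : E →L[ℂ] E := mfderiv 𝓘(ℂ, E) 𝓘(ℂ, E) (MulAut.conj g : G ≃* G) 1
  have h' : ∀ u : E, Ad g (u : LieAlg E G) = L u := fun u =>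
    congrArg (fun L : E →L[ℝ] E => L u) h
  exact (h' _).trans ((map_smul L c (v : E)).trans (congrArg (fun u : E => c • u) (h' v).symm))

theorem differential_comp (f h : G ≃* G) (hf : ContMDiff 𝓘(ℝ, E) 𝓘(ℝ, E) ∞ f)
    (hh : ContMDiff 𝓘(ℝ, E) 𝓘(ℝ, E) ∞ h) (v : LieAlg E G) :
    differential E (h.trans f) v = differential E f (differential E h v) := by
  have := mfderiv_comp (I' := 𝓘(ℝ, E)) (1 : G) ((hf (h 1)).mdifferentiableAt (by simp))
    ((hh 1).mdifferentiableAt (by simp))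
  rw [map_one] at this
  exact congrArg (fun L : E →L[ℝ] E => L v) this

theorem differential_Ad [LieGroup 𝓘(ℂ, E) ω G] (f : G ≃* G)
    (hf : ContMDiff 𝓘(ℝ, E) 𝓘(ℝ, E) ∞ f) (g : G) (v : LieAlg E G) :
    differential E f (Ad g v) = Ad (f g) (differential E f v) := by
  have hc : ∀ g : G, ContMDiff 𝓘(ℝ, E) 𝓘(ℝ, E) ∞ (MulAut.conj g : G ≃* G) := fun g =>
    (contMDiff_real (contMDiff_conj g)).of_le le_top
  rw [Ad, Ad, ← differential_comp _ _ hf (hc g), ← differential_comp _ _ (hc (f g)) hf]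
  congr 2
  ext x
  simp

instance [FiniteDimensional ℂ E] : Module.Finite ℂ (LieAlg E G) :=
  inferInstanceAs (Module.Finite ℂ E)

/-! ### Involutions of a complex Lie group -/

variable (E) in
/-- An antiholomorphic involutive automorphism of the complex Lie group `G`. -/
structure IsAntiholomorphicInvolution (f : G ≃* G) : Prop where
  smooth : ContMDiff 𝓘(ℝ, E) 𝓘(ℝ, E) ∞ f
  involutive : ∀ g, f (f g) = g
  conj_linear : ∀ (g : G) (v : E),
    realDeriv f g (Complex.I • v) = -(Complex.I • realDeriv f g v)

theorem IsAntiholomorphicInvolution.differential_I {f : G ≃* G}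
    (hf : IsAntiholomorphicInvolution E f) (v : LieAlg E G) :
    differential E f (Complex.I • v) = -(Complex.I • differential E f v) :=
  hf.conj_linear 1 v

variable [CompleteSpace E] [LieGroup 𝓘(ℂ, E) ω G]

variable (E) in
/-- `f` is a compact real form: an antiholomorphic involution such that the Killing form is
negative definite on the real Lie algebra of fixed vectors in `𝔤` (on which it is real). -/
def IsCompactRealForm (f : G ≃* G) : Prop :=
  IsAntiholomorphicInvolution E f ∧
    ∀ v : LieAlg E G, differential E f v = v → v ≠ 0 → (killingForm ℂ (LieAlg E G) v v).re < 0

variable (E) in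
/-- `f` is a split real form: an antiholomorphic involution preserving a Cartan subalgebra `𝔥` of
`𝔤` such that `ad x` has only real eigenvalues for each `f`-fixed `x ∈ 𝔥`. -/
def IsSplitRealForm (f : G ≃* G) : Prop :=
  IsAntiholomorphicInvolution E f ∧
    ∃ 𝔥 : LieSubalgebra ℂ (LieAlg E G), 𝔥.IsCartanSubalgebra ∧
      (∀ x ∈ 𝔥, differential E f x ∈ 𝔥) ∧
      ∀ x ∈ 𝔥, differential E f x = x →
        ∀ c : ℂ, Module.End.HasEigenvalue (LieAlgebra.ad ℂ (LieAlg E G) x) c → c.im = 0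

variable (E G) in
/-- A commuting pair of a compact real form `ρ₀` and a split real form `τ₀` of `G`. -/
structure RealForms where
  /-- The compact real form. -/
  rho : G ≃* G
  /-- The split real form. -/
  tau : G ≃* G
  compact : IsCompactRealForm E rho
  split : IsSplitRealForm E tau
  commute : ∀ g, rho (tau g) = tau (rho g)

namespace RealForms
variable (R : RealForms E G)

/-- The involution `σ₀ = ρ₀ τ₀` of `G`. -/
def sigma : G ≃* G := R.tau.trans R.rho

theorem sigma_sigma (g : G) : R.sigma (R.sigma g) = g := by
  change R.rho (R.tau (R.rho (R.tau g))) = g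
  rw [R.commute (R.rho (R.tau g)), R.compact.1.involutive, R.split.1.involutive]

theorem contMDiff_sigma : ContMDiff 𝓘(ℝ, E) 𝓘(ℝ, E) ∞ R.sigma :=
  R.compact.1.smooth.comp R.split.1.smooth

theorem sigma_symm : R.sigma.symm = R.sigma := by
  ext g
  rw [MulEquiv.symm_apply_eq, R.sigma_sigma]

/-- The differential of `σ₀`, a complex-linear endomorphism of `𝔤`. -/
def dsigma : LieAlg E G →ₗ[ℂ] LieAlg E G where
  toFun := differential E R.sigma
  map_add' := map_add _
  map_smul' c v := by
    have h : ∀ v, differential E R.sigma v = differential E R.rho (differential E R.tau v) :=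
      differential_comp _ _ R.compact.1.smooth R.split.1.smooth
    have hI : differential E R.sigma (Complex.I • v) = Complex.I • differential E R.sigma v := by
      rw [h, h, R.split.1.differential_I, map_neg, R.compact.1.differential_I, neg_neg]
    have hc : ∀ w : LieAlg E G, c • w = c.re • w + c.im • Complex.I • w := by
      intro w
      conv_lhs => rw [← Complex.re_add_im c]
      rw [add_smul, mul_smul]
      rfl
    rw [hc, map_add, map_smul, map_smul, hI, RingHom.id_apply, hc]

theorem dsigma_lie (v w : LieAlg E G) : R.dsigma ⁅v, w⁆ = ⁅R.dsigma v, R.dsigma w⁆ :=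
  differential_lie _ R.contMDiff_sigma (by rw [R.sigma_symm]; exact R.contMDiff_sigma) v w

theorem dsigma_Ad (g : G) (v : LieAlg E G) : R.dsigma (Ad g v) = Ad (R.sigma g) (R.dsigma v) :=
  differential_Ad _ R.contMDiff_sigma g v

end RealForms

/-- Principal nilpotent elements of a complex Lie algebra: `ad x` is nilpotent and the centralizer
of `x` has dimension the rank of the Lie algebra. -/
def IsPrincipalNilpotent {L : Type*} [LieRing L] [LieAlgebra ℂ L] [Module.Finite ℂ L] (x : L) :
    Prop :=
  IsNilpotent (LieAlgebra.ad ℂ L x) ∧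
    Module.finrank ℂ (LinearMap.ker (LieAlgebra.ad ℂ L x)) = LieAlgebra.rank ℂ L

end LieGroup

/-! ### Principal bundles -/

/-- The model space of a smooth surface. -/
abbrev Plane : Type := EuclideanSpace ℝ (Fin 2)

/-- A smooth principal `G`-bundle with total space `P` over the surface `S`. -/
structure PrincipalBundle (E G F S P : Type*)
    [NormedAddCommGroup E] [NormedSpace ℂ E] [TopologicalSpace G] [ChartedSpace E G] [Group G]
    [TopologicalSpace S] [ChartedSpace Plane S]
    [NormedAddCommGroup F] [NormedSpace ℝ F] [TopologicalSpace P] [ChartedSpace F P] where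
  /-- The projection. -/
  proj : P → S
  /-- The right action of the structure group. -/
  act : P → G → P
  act_one : ∀ p, act p 1 = p
  act_mul : ∀ p g h, act p (g * h) = act (act p g) h
  proj_act : ∀ p g, proj (act p g) = proj p
  contMDiff_proj : ContMDiff 𝓘(ℝ, F) (𝓡 2) ∞ proj
  contMDiff_act : ContMDiff (𝓘(ℝ, F).prod 𝓘(ℝ, E)) 𝓘(ℝ, F) ∞ (fun q : P × G => act q.1 q.2)
  /-- Around each point there is a smooth local section `s` such that `(x, g) ↦ s(x)·g` is a
  diffeomorphism onto the preimage of `U`, with inverse `p ↦ (proj p, t p)`. -/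
  locally_trivial : ∀ x : S, ∃ (U : Set S) (s : S → P) (t : P → G), IsOpen U ∧ x ∈ U ∧
    ContMDiffOn (𝓡 2) 𝓘(ℝ, F) ∞ s U ∧ ContMDiffOn 𝓘(ℝ, F) 𝓘(ℝ, E) ∞ t (proj ⁻¹' U) ∧
    (∀ y ∈ U, proj (s y) = y) ∧ (∀ y ∈ U, ∀ g, t (act (s y) g) = g) ∧
    ∀ p ∈ proj ⁻¹' U, act (s (proj p)) (t p) = p

section Bundle

variable {E G F S P : Type*}
  [NormedAddCommGroup E] [NormedSpace ℂ E] [CompleteSpace E]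
  [TopologicalSpace G] [ChartedSpace E G] [Group G] [LieGroup 𝓘(ℂ, E) ω G]
  [TopologicalSpace S] [ChartedSpace Plane S]
  [NormedAddCommGroup F] [NormedSpace ℝ F] [TopologicalSpace P] [ChartedSpace F P]

/-- The fibre of `P` over `x`. -/
abbrev PrincipalBundle.Fiber (B : PrincipalBundle E G F S P) (x : S) : Type _ :=
  {p : P // B.proj p = x}

/-- The right translation of a fibre by a group element. -/
def PrincipalBundle.Fiber.act {B : PrincipalBundle E G F S P} {x : S} (p : B.Fiber x) (g : G) :
    B.Fiber x :=
  ⟨B.act p.1 g, (B.proj_act p.1 g).trans p.2⟩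

/-- The fibre at `x` of the adjoint bundle `𝔤_P = P ×_G 𝔤`, realised as the Lie algebra of
equivariant maps from the fibre `P_x` to `𝔤`: the class `[p, X]` is the map sending `p·g` to
`Ad(g⁻¹) X`. -/
def PrincipalBundle.AdjFiber (B : PrincipalBundle E G F S P) (x : S) :
    Submodule ℂ (B.Fiber x → LieAlg E G) where
  carrier := {f | ∀ p g, f (p.act g) = Ad g⁻¹ (f p)}
  add_mem' {a b} ha hb p g := by simp only [Pi.add_apply, ha p g, hb p g, map_add]
  zero_mem' p g := by simp only [Pi.zero_apply, map_zero]
  smul_mem' c a ha p g := by simp only [Pi.smul_apply, ha p g, Ad_smul]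

section AdjFiber
variable {B : PrincipalBundle E G F S P} {x : S}

/-- The pointwise Lie bracket on the fibres of `𝔤_P`. -/
instance : LieRing (B.AdjFiber x) where
  bracket a b := ⟨fun p => ⁅a.1 p, b.1 p⁆, fun p g => by
    change ⁅a.1 (p.act g), b.1 (p.act g)⁆ = Ad g⁻¹ ⁅a.1 p, b.1 p⁆
    rw [a.2 p g, b.2 p g, Ad_lie]⟩
  add_lie _ _ _ := Subtype.ext (funext fun _ => add_lie _ _ _)
  lie_add _ _ _ := Subtype.ext (funext fun _ => lie_add _ _ _)
  lie_self _ := Subtype.ext (funext fun _ => lie_self _)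
  leibniz_lie _ _ _ := Subtype.ext (funext fun _ => leibniz_lie _ _ _)

instance : LieAlgebra ℂ (B.AdjFiber x) where
  lie_smul _ _ _ := Subtype.ext (funext fun _ => lie_smul _ _ _)

theorem PrincipalBundle.AdjFiber.lie_apply (a b : B.AdjFiber x) (p : B.Fiber x) :
    (⁅a, b⁆ : B.AdjFiber x).1 p = ⁅a.1 p, b.1 p⁆ := rfl

end AdjFiber

/-- A `σ₀`-structure on `P`: a smooth involution `σ` of `P`, over the identity of `S`, with
`σ(p·g) = σ(p)·σ₀(g)`, whose fixed point locus is a reduction of the structure group to the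
fixed points of `σ₀`, i.e. meets each fibre. -/
structure SigmaStructure (R : RealForms E G) (B : PrincipalBundle E G F S P) where
  /-- The involution. -/
  toFun : P → P
  smooth : ContMDiff 𝓘(ℝ, F) 𝓘(ℝ, F) ∞ toFun
  involutive : ∀ p, toFun (toFun p) = p
  proj_toFun : ∀ p, B.proj (toFun p) = B.proj p
  toFun_act : ∀ p g, toFun (B.act p g) = B.act (toFun p) (R.sigma g)
  exists_fixed : ∀ x, ∃ p, B.proj p = x ∧ toFun p = p

namespace SigmaStructure
variable {R : RealForms E G} {B : PrincipalBundle E G F S P} (s : SigmaStructure R B)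

/-- The action of `σ` on a fibre of `P`. -/
def fiber {x : S} (p : B.Fiber x) : B.Fiber x := ⟨s.toFun p.1, (s.proj_toFun p.1).trans p.2⟩

/-- The involution of the fibre of `𝔤_P` at `x` induced by `σ`, sending `[p, X]` to
`[σ(p), σ₀(X)]`. -/
def adj (x : S) : B.AdjFiber x →ₗ[ℂ] B.AdjFiber x where
  toFun f := ⟨fun p => R.dsigma (f.1 (s.fiber p)), fun p g => by
    have h : s.fiber (p.act g) = (s.fiber p).act (R.sigma g) := Subtype.ext (s.toFun_act p.1 g)
    change R.dsigma (f.1 (s.fiber (p.act g))) = Ad g⁻¹ (R.dsigma (f.1 (s.fiber p)))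
    rw [h, f.2, R.dsigma_Ad, map_inv, R.sigma_sigma]⟩
  map_add' f f' := Subtype.ext (funext fun p => map_add R.dsigma _ _)
  map_smul' c f := Subtype.ext (funext fun p => map_smul R.dsigma c _)

theorem adj_lie (x : S) (a b : B.AdjFiber x) : s.adj x ⁅a, b⁆ = ⁅s.adj x a, s.adj x b⁆ :=
  Subtype.ext (funext fun _ => R.dsigma_lie _ _)

theorem adj_adj (x : S) (a : B.AdjFiber x) : s.adj x (s.adj x a) = a := by
  refine Subtype.ext (funext fun p => ?_)
  change R.dsigma (R.dsigma (a.1 (s.fiber (s.fiber p)))) = a.1 p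
  have h : s.fiber (s.fiber p) = p := Subtype.ext (s.involutive p.1)
  have h2 := differential_comp (E := E) R.sigma R.sigma R.contMDiff_sigma R.contMDiff_sigma
  have h3 : R.sigma.trans R.sigma = MulEquiv.refl G := by ext g; exact R.sigma_sigma g
  rw [h]
  refine (h2 _).symm.trans ?_
  rw [h3]
  exact congrArg (fun L : E →L[ℝ] E => L (a.1 p)) (mfderiv_id (I := 𝓘(ℝ, E)) (x := (1 : G)))

end SigmaStructure

/-! ### Differential forms with values in the adjoint bundle -/

/-- Families of alternating `k`-forms on the tangent spaces of `S` with values in `𝔤_P`. -/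
def PrincipalBundle.PreForm (B : PrincipalBundle E G F S P) (k : ℕ) : Type _ :=
  ∀ x : S, TangentSpace (𝓡 2) x [⋀^Fin k]→ₗ[ℝ] B.AdjFiber x

instance (B : PrincipalBundle E G F S P) (k : ℕ) : AddCommGroup (B.PreForm k) :=
  inferInstanceAs (AddCommGroup (∀ x : S, TangentSpace (𝓡 2) x [⋀^Fin k]→ₗ[ℝ] B.AdjFiber x))

instance (B : PrincipalBundle E G F S P) (k : ℕ) : Module ℂ (B.PreForm k) :=
  inferInstanceAs (Module ℂ (∀ x : S, TangentSpace (𝓡 2) x [⋀^Fin k]→ₗ[ℝ] B.AdjFiber x))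

section
variable {B : PrincipalBundle E G F S P} {k : ℕ} (a b : B.PreForm k) (c : ℂ) (x : S)
  (v : Fin k → TangentSpace (𝓡 2) x)

theorem PrincipalBundle.PreForm.add_apply : (a + b) x v = a x v + b x v := rfl

theorem PrincipalBundle.PreForm.neg_apply : (-a) x v = -a x v := rfl

theorem PrincipalBundle.PreForm.smul_apply : (c • a) x v = c • a x v := rfl

end

/-- The value of `ω(X₁, …, X_k)` for vector fields `X_i` on `S`, as a map `P → 𝔤`. -/
def PrincipalBundle.PreForm.eval {B : PrincipalBundle E G F S P} {k : ℕ} (w : B.PreForm k)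
    (X : Fin k → ∀ x : S, TangentSpace (𝓡 2) x) (p : P) : E :=
  (w (B.proj p) fun i => X i (B.proj p)).1 ⟨p, rfl⟩

theorem PrincipalBundle.PreForm.eval_fiber {B : PrincipalBundle E G F S P} {k : ℕ}
    (w : B.PreForm k) (X : Fin k → ∀ x : S, TangentSpace (𝓡 2) x) {x : S} (q : B.Fiber x) :
    (w x fun i => X i x).1 q = w.eval X q.1 := by
  obtain ⟨q, rfl⟩ := q
  rfl

section Smooth
variable [IsManifold (𝓡 2) ∞ S]

/-- The vector field `X` on `S` is smooth on `U`. -/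
def IsSmoothFieldOn (X : ∀ x : S, TangentSpace (𝓡 2) x) (U : Set S) : Prop :=
  ContMDiffOn (𝓡 2) (𝓡 2).tangent ∞ (fun x => (⟨x, X x⟩ : TangentBundle (𝓡 2) S)) U

/-- The space `Ω^k(S, 𝔤_P)` of smooth `𝔤_P`-valued `k`-forms: those whose value on any `k` smooth
(local) vector fields is a smooth (local) section of `𝔤_P`, i.e. a smooth equivariant map to `𝔤`
on the part of `P` over its domain. -/
def PrincipalBundle.AdjForm (B : PrincipalBundle E G F S P) (k : ℕ) :
    Submodule ℂ (B.PreForm k) where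
  carrier := {w | ∀ (U : Set S) (X : Fin k → ∀ x : S, TangentSpace (𝓡 2) x), IsOpen U →
    (∀ i, IsSmoothFieldOn (X i) U) →
      ContMDiffOn 𝓘(ℝ, F) 𝓘(ℝ, E) ∞ (PrincipalBundle.PreForm.eval w X) (B.proj ⁻¹' U)}
  add_mem' {a b} ha hb U X hU hX := (ha U X hU hX).add (hb U X hU hX)
  zero_mem' U X hU hX := contMDiffOn_const
  smul_mem' c a ha U X hU hX := by
    have h : ContDiff ℝ ∞ (fun v : E => c • v) := contDiff_const_smul c
    exact h.contMDiff.comp_contMDiffOn (ha U X hU hX)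

/-- The action of `σ` on `Ω^k(S, 𝔤_P)`, by composition with the involution of `𝔤_P`. -/
def SigmaStructure.onForms {R : RealForms E G} {B : PrincipalBundle E G F S P}
    (s : SigmaStructure R B) (k : ℕ) : B.AdjForm k →ₗ[ℂ] B.AdjForm k where
  toFun w := ⟨fun x => ((s.adj x).restrictScalars ℝ).compAlternatingMap (w.1 x),
    fun U X hU hX => by
      let D : E →L[ℝ] E := realDeriv R.sigma 1
      have h1 : ContMDiffOn 𝓘(ℝ, F) 𝓘(ℝ, E) ∞
          (fun p => PrincipalBundle.PreForm.eval w.1 X (s.toFun p)) (B.proj ⁻¹' U) :=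
        (w.2 U X hU hX).comp s.smooth.contMDiffOn fun p hp => by
          simpa only [Set.mem_preimage, s.proj_toFun] using hp
      refine (D.contDiff.contMDiff.comp_contMDiffOn h1).congr fun p _ => ?_
      exact congrArg D (PrincipalBundle.PreForm.eval_fiber w.1 X (s.fiber ⟨p, rfl⟩))⟩
  map_add' a b := Subtype.ext (funext fun x => AlternatingMap.ext fun v =>
    map_add (s.adj x) (a.1 x v) (b.1 x v))
  map_smul' c a := Subtype.ext (funext fun x => AlternatingMap.ext fun v =>
    map_smul (s.adj x) c (a.1 x v))

end Smooth

/-- The wedge bracket `[Φ ∧ w]` of a `1`-form and a `k`-form with values in `𝔤_P`: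
`[Φ ∧ w](v₀, …, v_k) = ∑ i, (-1)^i [Φ(v_i), w(v₀, …, v_k without v_i)]`. -/
def PrincipalBundle.PreForm.wedgeBracket {B : PrincipalBundle E G F S P} {k : ℕ}
    (Φ : B.PreForm 1) (w : B.PreForm k) : B.PreForm (k + 1) := fun x =>
  AlternatingMap.alternatizeUncurryFin
    { toFun := fun v => ((LieAlgebra.ad ℂ (B.AdjFiber x) (Φ x fun _ => v)).restrictScalars
        ℝ).compAlternatingMap (w x)
      map_add' := fun u v => by
        have h : (Φ x fun _ => u + v) = (Φ x fun _ => u) + Φ x fun _ => v :=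
          map_add ((AlternatingMap.ofSubsingleton ℝ _ _ (0 : Fin 1)).symm (Φ x)) u v
        rw [h, map_add]
        rfl
      map_smul' := fun c v => by
        have h : (Φ x fun _ => c • v) = c • Φ x fun _ => v :=
          map_smul ((AlternatingMap.ofSubsingleton ℝ _ _ (0 : Fin 1)).symm (Φ x)) c v
        refine AlternatingMap.ext fun u => ?_
        change ⁅(Φ x fun _ => c • v), w x u⁆ = c • ⁅(Φ x fun _ => v), w x u⁆
        rw [h]
        exact smul_lie (c : ℂ) _ _ }

theorem PrincipalBundle.PreForm.wedgeBracket_apply {B : PrincipalBundle E G F S P} {k : ℕ}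
    (Φ : B.PreForm 1) (w : B.PreForm k) (x : S) (v : Fin (k + 1) → TangentSpace (𝓡 2) x) :
    Φ.wedgeBracket w x v =
      ∑ i : Fin (k + 1), (-1 : ℤ) ^ (i : ℕ) • ⁅Φ x fun _ => v i, w x (i.removeNth v)⁆ :=
  AlternatingMap.alternatizeUncurryFin_apply _ _

variable (E G) in
/-- The Lie bracket of `𝔤`, as a continuous real-bilinear map. -/
def bracketCLM [FiniteDimensional ℂ E] : E →L[ℝ] E →L[ℝ] E :=
  let L : E →ₗ[ℝ] E →ₗ[ℝ] E := LinearMap.mk₂ ℝ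
    (fun a b => Bracket.bracket (L := LieAlg E G) (M := LieAlg E G) a b)
    (fun a b c => add_lie (L := LieAlg E G) (M := LieAlg E G) a b c)
    (fun r a b => smul_lie (R := ℂ) (L := LieAlg E G) (M := LieAlg E G) (r : ℂ) a b)
    (fun a b c => lie_add (L := LieAlg E G) (M := LieAlg E G) a b c)
    (fun r a b => lie_smul (R := ℂ) (L := LieAlg E G) (M := LieAlg E G) (r : ℂ) a b)
  LinearMap.toContinuousLinearMap (LinearMap.toContinuousLinearMap.toLinearMap ∘ₗ L)

variable [IsManifold (𝓡 2) ∞ S] [FiniteDimensional ℂ E]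

/-- The differential `ad_Φ : Ω^k(S, 𝔤_P) → Ω^{k+1}(S, 𝔤_P)`, `w ↦ [Φ ∧ w]`. -/
def adForm {B : PrincipalBundle E G F S P} (Φ : B.AdjForm 1) (k : ℕ) :
    B.AdjForm k →ₗ[ℂ] B.AdjForm (k + 1) where
  toFun w := ⟨Φ.1.wedgeBracket w.1, fun U X hU hX => by
    have h : ∀ p, (Φ.1.wedgeBracket w.1).eval X p = ∑ i : Fin (k + 1), (-1 : ℝ) ^ (i : ℕ) •
        bracketCLM E G (Φ.1.eval (fun _ => X i) p) (w.1.eval (i.removeNth X) p) := by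
      intro p
      let ev : B.AdjFiber (B.proj p) →+ E :=
        { toFun := fun f => f.1 ⟨p, rfl⟩, map_zero' := rfl, map_add' := fun _ _ => rfl }
      have h1 := congrArg ev (PrincipalBundle.PreForm.wedgeBracket_apply Φ.1 w.1 (B.proj p)
        fun i => X i (B.proj p))
      rw [map_sum] at h1
      refine h1.trans (Finset.sum_congr rfl fun i _ => ?_)
      rw [map_zsmul, ← Int.cast_smul_eq_zsmul ℝ]
      push_cast
      rfl
    refine ContMDiffOn.congr ?_ fun p _ => h p
    refine contMDiffOn_finsetSum fun i _ => ?_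
    refine ((-1 : ℝ) ^ (i : ℕ) • ContinuousLinearMap.id ℝ E).contDiff.contMDiff.comp_contMDiffOn ?_
    exact ((bracketCLM E G).contDiff.contMDiff.comp_contMDiffOn
      (Φ.2 U (fun _ => X i) hU fun _ => hX i)).clm_apply
      (w.2 U (i.removeNth X) hU fun j => hX _)⟩
  map_add' a b := Subtype.ext (funext fun x => AlternatingMap.ext fun v => by
    change Φ.1.wedgeBracket (a.1 + b.1) x v =
      Φ.1.wedgeBracket a.1 x v + Φ.1.wedgeBracket b.1 x v
    simp only [PrincipalBundle.PreForm.wedgeBracket_apply, PrincipalBundle.PreForm.add_apply,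
      lie_add, smul_add, Finset.sum_add_distrib])
  map_smul' c a := Subtype.ext (funext fun x => AlternatingMap.ext fun v => by
    change Φ.1.wedgeBracket (c • a.1) x v = c • Φ.1.wedgeBracket a.1 x v
    simp only [PrincipalBundle.PreForm.wedgeBracket_apply, PrincipalBundle.PreForm.smul_apply,
      lie_smul, Finset.smul_sum, smul_comm c])

theorem SigmaStructure.onForms_adForm {R : RealForms E G} {B : PrincipalBundle E G F S P}
    (s : SigmaStructure R B) (Φ : B.AdjForm 1) (k : ℕ) (w : B.AdjForm k) :
    s.onForms (k + 1) (adForm Φ k w) = adForm (s.onForms 1 Φ) k (s.onForms k w) := by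
  refine Subtype.ext (funext fun x => AlternatingMap.ext fun v => ?_)
  change s.adj x (Φ.1.wedgeBracket w.1 x v) =
    (s.onForms 1 Φ).1.wedgeBracket (s.onForms k w).1 x v
  simp only [PrincipalBundle.PreForm.wedgeBracket_apply, map_sum, map_zsmul, s.adj_lie]
  rfl

theorem adForm_neg {B : PrincipalBundle E G F S P} (Φ : B.AdjForm 1) (k : ℕ)
    (w : B.AdjForm k) : adForm (-Φ) k w = -(adForm Φ k w) := by
  refine Subtype.ext (funext fun x => AlternatingMap.ext fun v => ?_)
  change (-Φ.1).wedgeBracket w.1 x v = -(Φ.1.wedgeBracket w.1 x v)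
  simp only [PrincipalBundle.PreForm.wedgeBracket_apply, PrincipalBundle.PreForm.neg_apply,
    neg_lie, smul_neg, Finset.sum_neg_distrib]

end Bundle

/-! ### Fock bundles and their cohomology -/

/-- A `G`-Fock bundle `(P, Φ, σ)` over the surface `S`. -/
structure FockBundle (E G F S P : Type*)
    [NormedAddCommGroup E] [NormedSpace ℂ E] [FiniteDimensional ℂ E] [CompleteSpace E]
    [TopologicalSpace G] [ChartedSpace E G] [Group G] [LieGroup 𝓘(ℂ, E) ω G]
    [TopologicalSpace S] [ChartedSpace Plane S] [IsManifold (𝓡 2) ∞ S]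
    [NormedAddCommGroup F] [NormedSpace ℝ F] [TopologicalSpace P] [ChartedSpace F P]
    (R : RealForms E G) where
  /-- The principal `G`-bundle. -/
  bundle : PrincipalBundle E G F S P
  /-- The `σ₀`-structure. -/
  sigma : SigmaStructure R bundle
  /-- The Fock field `Φ ∈ Ω¹(S, 𝔤_P)`. -/
  Phi : bundle.AdjForm 1
  wedge_self : adForm Phi 1 Phi = 0
  /-- `Φ(v)` is principal nilpotent in the fibre of `𝔤_P` for each non-zero tangent vector `v`; the
  fibre is identified with `𝔤` by a point `p` of `P`. -/
  principal_nilpotent : ∀ (x : S) (v : TangentSpace (𝓡 2) x), v ≠ 0 →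
    ∀ p : bundle.Fiber x, IsPrincipalNilpotent ((Phi.1 x fun _ => v).1 p)
  sigma_Phi : sigma.onForms 1 Phi = -Phi

namespace FockBundle

variable {E G F S P : Type*}
  [NormedAddCommGroup E] [NormedSpace ℂ E] [FiniteDimensional ℂ E] [CompleteSpace E]
  [TopologicalSpace G] [ChartedSpace E G] [Group G] [LieGroup 𝓘(ℂ, E) ω G]
  [TopologicalSpace S] [ChartedSpace Plane S] [IsManifold (𝓡 2) ∞ S]
  [NormedAddCommGroup F] [NormedSpace ℝ F] [TopologicalSpace P] [ChartedSpace F P]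
  {R : RealForms E G} (B : FockBundle E G F S P R)

/-- An infinitesimal gauge transformation `η ∈ Ω⁰(S, 𝔤_P)` is an infinitesimal automorphism if it
preserves `Φ` and `σ` to first order: the variation `δΦ = [Φ, η]` that it induces vanishes, and it
is fixed by `σ`, i.e. its flow on `P` commutes with the involution `σ`. -/
def IsInfinitesimalAutomorphism (η : B.bundle.AdjForm 0) : Prop :=
  adForm B.Phi 0 η = 0 ∧ B.sigma.onForms 0 η = η

/-- The space of `k`-cocycles of the complex `(Ω^•(S, 𝔤_P), ad_Φ)`. -/
def cocycles (k : ℕ) : Submodule ℂ (B.bundle.AdjForm k) := LinearMap.ker (adForm B.Phi k)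

/-- The space of `k`-coboundaries of the complex `(Ω^•(S, 𝔤_P), ad_Φ)`. -/
def coboundaries : ∀ k : ℕ, Submodule ℂ (B.bundle.AdjForm k)
  | 0 => ⊥
  | k + 1 => LinearMap.range (adForm B.Phi k)

/-- The `Φ`-cohomology group `H^k(Φ)`: cocycles modulo those cocycles that are coboundaries. -/
abbrev Cohomology (k : ℕ) : Type _ :=
  B.cocycles k ⧸ (B.coboundaries k).comap (B.cocycles k).subtype

theorem sigma_ad (k : ℕ) (w : B.bundle.AdjForm k) :
    B.sigma.onForms (k + 1) (adForm B.Phi k w) = -(adForm B.Phi k (B.sigma.onForms k w)) := by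
  rw [B.sigma.onForms_adForm, B.sigma_Phi, adForm_neg]

theorem sigma_mem_cocycles (k : ℕ) (w : B.bundle.AdjForm k) (hw : w ∈ B.cocycles k) :
    B.sigma.onForms k w ∈ B.cocycles k := by
  have h := B.sigma_ad k w
  rw [LinearMap.mem_ker.1 hw, map_zero] at h
  exact LinearMap.mem_ker.2 (neg_eq_zero.1 h.symm)

theorem sigma_mem_coboundaries (k : ℕ) (w : B.bundle.AdjForm k) (hw : w ∈ B.coboundaries k) :
    B.sigma.onForms k w ∈ B.coboundaries k := by
  cases k with
  | zero =>
    have h : w = 0 := hw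
    rw [h, map_zero]
    exact Submodule.zero_mem _
  | succ k =>
    obtain ⟨b, rfl⟩ := hw
    exact ⟨-(B.sigma.onForms k b), by rw [map_neg, B.sigma_ad]⟩

/-- The action of `σ` on cocycles. -/
def sigmaCocycles (k : ℕ) : B.cocycles k →ₗ[ℂ] B.cocycles k :=
  (B.sigma.onForms k).restrict (B.sigma_mem_cocycles k)

/-- The action of `σ` on `H^k(Φ)`. -/
def sigmaCohomology (k : ℕ) : B.Cohomology k →ₗ[ℂ] B.Cohomology k :=
  Submodule.mapQ _ _ (B.sigmaCocycles k) fun w hw => B.sigma_mem_coboundaries k w.1 hw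

/-- `H^{k,σ}(Φ)`: the subspace of `H^k(Φ)` of classes represented by `σ`-invariant cocycles. -/
def invariantCohomology (k : ℕ) : Submodule ℂ (B.Cohomology k) :=
  (LinearMap.eqLocus (B.sigmaCocycles k) LinearMap.id).map (Submodule.mkQ _)

end FockBundle
end Fock

end

/-! The whole statement reduces to one fact: a `σ`-invariant cocycle is a coboundary
(`mem_coboundaries_of_invariant`). In degree 0 this excludes infinitesimal automorphisms. For a
general class `c`, the class `c + σ c` has an invariant representative, hence vanishes, so `σ c =
-c`.

The algebraic core is a dimension count in `𝔤`. Let `K` be the fixed space of the complex-linear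
involution `σ₀ = ρ₀ τ₀`. On `K` the conjugations `ρ₀` and `τ₀` agree. The Hermitian form `κ(v, ρ₀
v)` is negative definite. On the sum of the split Cartan subalgebra and the positive root spaces,
`κ(v, τ₀ v)` is nonnegative, because each root space is `τ₀`-stable and only the Cartan part
contributes. So `K` meets this subspace, and its opposite, only in zero, which gives `2 dim K + rk 𝔤
≤ dim 𝔤` (`two_mul_finrank_add_rank_le`). If `z` is principal nilpotent with `σ₀ z = -z`, then `ad
z` exchanges the two eigenspaces of `σ₀` and has kernel of dimension `rk 𝔤`. The bound then forces
`ad z` to be injective on `K` and to have `K` in its image (`principal_nilpotent_odd`).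

Injectivity settles degree 0 fibre by fibre. In degrees 1 and 2, contract an invariant cocycle with
a local vector field `V` without zeros and solve `[Φ(V), f] = w(V, …)`. The kernel of `ad Φ(V)` has
constant dimension, so a smooth generalized inverse of `ad Φ(V)` produces a smooth `f`
(`exists_localHomotopy`). In degree 1 the equation in the other directions follows from the cocycle
condition and injectivity (`lie_field_eq_of_lie_field_eq`); in degree 2 one direction transverse to
`V` is enough. Since `ad_Φ` involves no derivatives, it is linear over functions, and the local
solutions are glued by a partition of unity (`exists_adForm_eq`). -/

noncomputable section

namespace Fock

/-! ### Roots, the Killing form and the dimension bound for the fixed space of `σ₀`. -/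

section LieTheory

open LieAlgebra LieModule Module

variable {L : Type*} [LieRing L] [LieAlgebra ℂ L] [FiniteDimensional ℂ L]

/-- The sum of the root spaces whose roots satisfy a predicate. -/
def rootSum (H : LieSubalgebra ℂ L) [H.IsCartanSubalgebra] (p : Weight ℂ H L → Prop) :
    Submodule ℂ L :=
  ⨆ (α : Weight ℂ H L) (_ : p α), (rootSpace H α).toSubmodule

section rootSum
variable {H : LieSubalgebra ℂ L} [H.IsCartanSubalgebra] {p : Weight ℂ H L → Prop}

omit [FiniteDimensional ℂ L] in
theorem rootSum_le {N : Submodule ℂ L}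
    (h : ∀ α, p α → ∀ v ∈ rootSpace H α, v ∈ N) : rootSum H p ≤ N :=
  iSup₂_le fun α hα v hv => h α hα v hv

omit [FiniteDimensional ℂ L] in
theorem rootSpace_le_rootSum {α : Weight ℂ H L} (hα : p α) :
    (rootSpace H α).toSubmodule ≤ rootSum H p :=
  le_iSup₂_of_le α hα le_rfl

theorem killingForm_eq_zero_of_mem_cartan_of_mem_rootSum (hp : ∀ α, p α → α.IsNonZero) {h n : L}
    (hh : h ∈ H) (hn : n ∈ rootSum H p) : killingForm ℂ L h n = 0 := by
  have : rootSum H p ≤ LinearMap.ker (killingForm ℂ L h) := rootSum_le fun α hα v hv => by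
    have h0 : h ∈ rootSpace H (0 : H → ℂ) := by
      rw [rootSpace_zero_eq]; exact hh
    refine killingForm_apply_eq_zero_of_mem_rootSpace_of_add_ne_zero ℂ L H h0 hv ?_
    rw [zero_add]
    exact hp α hα
  exact this hn

/-- Root spaces pair nontrivially under the Killing form only for opposite roots, so a set of roots
containing no opposite pair spans an isotropic subspace. -/
theorem killingForm_eq_zero_of_mem_rootSum
    (hp : ∀ α β : Weight ℂ H L, p α → p β → (α + β : H → ℂ) ≠ 0) {m n : L}
    (hm : m ∈ rootSum H p) (hn : n ∈ rootSum H p) : killingForm ℂ L m n = 0 := by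
  have : rootSum H p ≤ LinearMap.ker ((killingForm ℂ L).flip n) := rootSum_le fun α hα v hv => by
    have : rootSum H p ≤ LinearMap.ker (killingForm ℂ L v) := rootSum_le fun β hβ w hw =>
      killingForm_apply_eq_zero_of_mem_rootSpace_of_add_ne_zero ℂ L H hv hw (hp α β hα hβ)
    exact this hn
  exact this hm

theorem cartan_sup_rootSum_eq_top :
    H.toSubmodule ⊔ rootSum H (fun α => α.IsNonZero) = ⊤ := by
  have h := (LieSubmodule.iSup_toSubmodule_eq_top.mpr <| iSup_genWeightSpace_eq_top' ℂ H L)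
  rw [eq_top_iff, ← h]
  refine iSup_le fun α => ?_
  by_cases hα : α.IsZero
  · refine le_sup_of_le_left ?_
    have h0 : (α : H → ℂ) = 0 := hα
    have h1 := rootSpace_zero_eq ℂ L H
    rw [← h0] at h1
    exact (congrArg LieSubmodule.toSubmodule h1).le
  · exact le_sup_of_le_right (rootSpace_le_rootSum hα)

end rootSum

variable [IsKilling ℂ L] {H : LieSubalgebra ℂ L} [H.IsCartanSubalgebra]

-- A regular element exists because finitely many proper subspaces, the kernels of the roots, cannot
-- cover `H`.
omit [IsKilling ℂ L] in
theorem exists_forall_weight_ne_zero (H : LieSubalgebra ℂ L) [H.IsCartanSubalgebra] :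
    ∃ x : H, ∀ α : Weight ℂ H L, α.IsNonZero → α x ≠ 0 := by
  obtain ⟨x, -, hx⟩ := Module.Dual.exists_forall_mem_ne_zero_of_forall_exists
    (⊤ : Submodule ℂ H) (fun α : H.root => ((α : Weight ℂ H L).toLinear : H →ₗ[ℂ] ℂ))
    (fun α => by
      by_contra! h
      have hα : (α : Weight ℂ H L).IsNonZero := LieSubalgebra.isNonZero_coe_root α
      exact hα (funext fun y => h y trivial))
  exact ⟨x, fun α hα => hx ⟨α, by simpa [LieSubalgebra.root] using hα⟩⟩

/-- The rank is bounded by the dimension of any Engel subalgebra. For regular `x` in `H`, `ad x` is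
invertible on every root space, so its generalized null space is no larger than `H`. -/
theorem rank_le_finrank_cartan (H : LieSubalgebra ℂ L) [H.IsCartanSubalgebra] :
    LieAlgebra.rank ℂ L ≤ finrank ℂ H := by
  obtain ⟨x, hx⟩ := exists_forall_weight_ne_zero H
  refine (rank_le_finrank_engel ℂ (x : L)).trans ?_
  set T := ad ℂ L (x : L)
  have hE : (LieSubalgebra.engel ℂ (x : L)).toSubmodule = LinearMap.ker (T ^ finrank ℂ L) := by
    ext y
    change y ∈ T.maxGenEigenspace 0 ↔ _
    rw [Module.End.maxGenEigenspace_eq_genEigenspace_finrank, Module.End.mem_genEigenspace_nat]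
    simp
  have htop : H.toSubmodule ⊔ LinearMap.range (T ^ finrank ℂ L) = ⊤ := by
    rw [eq_top_iff, ← cartan_sup_rootSum_eq_top (H := H)]
    refine sup_le le_sup_left (le_sup_of_le_right (rootSum_le fun α hα v hv => ?_))
    have h1 : T v = α x • v := IsKilling.lie_eq_smul_of_mem_rootSpace hv x
    have h2 : ∀ n : ℕ, (T ^ n) v = (α x) ^ n • v := fun n => by
      induction n with
      | zero => simp
      | succ n ih => rw [pow_succ', Module.End.mul_apply, ih, map_smul, h1, smul_smul, pow_succ]
    refine ⟨((α x) ^ finrank ℂ L)⁻¹ • v, ?_⟩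
    rw [map_smul, h2, smul_smul, inv_mul_cancel₀ (pow_ne_zero _ (hx α hα)), one_smul]
  have h1 := Submodule.finrank_add_le_finrank_add_finrank H.toSubmodule
    (LinearMap.range (T ^ finrank ℂ L))
  rw [htop, finrank_top] at h1
  have h2 := LinearMap.finrank_range_add_finrank_ker (T ^ finrank ℂ L)
  have h3 : finrank ℂ (LieSubalgebra.engel ℂ (x : L)) = finrank ℂ (LinearMap.ker (T ^ finrank ℂ L)) :=
    congrArg (fun W : Submodule ℂ L => finrank ℂ W) hE
  have h4 : finrank ℂ H = finrank ℂ H.toSubmodule := rfl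
  omega

omit [FiniteDimensional ℂ L] [IsKilling ℂ L] in
/-- The decomposition of a vector into real and imaginary parts for a conjugation. -/
theorem exists_eq_add_I_smul {τ : L →ₛₗ[starRingEnd ℂ] L} (hτ : ∀ v, τ (τ v) = v) (v : L) :
    ∃ a b : L, τ a = a ∧ τ b = b ∧ v = a + Complex.I • b ∧ τ v = a - Complex.I • b := by
  have hI : (Complex.I * (1 / 2 * Complex.I)) = -(1 / 2) := by
    linear_combination (1 / 2 : ℂ) * Complex.I_mul_I
  have h2 : starRingEnd ℂ 2 = 2 := Complex.conj_ofNat 2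
  refine ⟨(1 / 2 : ℂ) • (v + τ v), (1 / 2 * Complex.I) • (τ v - v), ?_, ?_, ?_, ?_⟩
  · rw [LinearMap.map_smulₛₗ, map_add, hτ, add_comm]
    simp [h2]
  · rw [LinearMap.map_smulₛₗ, map_sub, hτ, ← neg_sub, smul_neg, ← neg_smul]
    simp [h2]
  · rw [smul_smul, hI]
    module
  · rw [smul_smul, hI]
    module

omit [H.IsCartanSubalgebra] in
omit [FiniteDimensional ℂ L] [IsKilling ℂ L] in
theorem mem_cartan_parts {τ : L →ₛₗ[starRingEnd ℂ] L} (hτ : ∀ v, τ (τ v) = v)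
    (hH : ∀ x ∈ H, τ x ∈ H) {v : L} (hv : v ∈ H) :
    ∃ a ∈ H, ∃ b ∈ H, τ a = a ∧ τ b = b ∧ v = a + Complex.I • b ∧ τ v = a - Complex.I • b := by
  obtain ⟨a, b, ha, hb, e1, e2⟩ := exists_eq_add_I_smul hτ v
  have h1 : a = (1 / 2 : ℂ) • (v + τ v) := by rw [e2, e1]; module
  have h2 : b = (-(1 / 2) * Complex.I) • (v - τ v) := by
    rw [e2, e1]
    have : a + Complex.I • b - (a - Complex.I • b) = (2 * Complex.I) • b := by module
    rw [this, smul_smul]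
    have : -(1 / 2) * Complex.I * (2 * Complex.I) = 1 := by
      linear_combination (-1 : ℂ) * Complex.I_mul_I
    rw [this, one_smul]
  exact ⟨a, h1 ▸ H.smul_mem _ (H.add_mem hv (hH v hv)), b,
    h2 ▸ H.smul_mem _ (H.sub_mem hv (hH v hv)), ha, hb, e1, e2⟩

omit [FiniteDimensional ℂ L] [IsKilling ℂ L] in
theorem killingForm_conj_apply {v w a b : L} (e1 : v = a + Complex.I • b)
    (e2 : w = a - Complex.I • b) :
    killingForm ℂ L v w = killingForm ℂ L a a + killingForm ℂ L b b := by
  have hs : killingForm ℂ L a b = killingForm ℂ L b a := LieModule.traceForm_comm ℂ L L a b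
  rw [e1, e2]
  simp only [map_add, map_sub, map_smul, LinearMap.add_apply, LinearMap.smul_apply, smul_eq_mul, hs]
  linear_combination (-killingForm ℂ L b b) * Complex.I_mul_I

-- With `v = a + i b` for fixed `a` and `b`, the value `κ(v, ρ v)` is `κ(a, a) + κ(b, b)`:
-- negativity on the real form passes to the Hermitian form on all of `L`.
omit [FiniteDimensional ℂ L] [IsKilling ℂ L] in
theorem killingForm_conj_re_neg {ρ : L →ₛₗ[starRingEnd ℂ] L} (hρ : ∀ v, ρ (ρ v) = v)
    (hneg : ∀ v, ρ v = v → v ≠ 0 → (killingForm ℂ L v v).re < 0) {v : L} (hv : v ≠ 0) :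
    (killingForm ℂ L v (ρ v)).re < 0 := by
  obtain ⟨a, b, ha, hb, e1, e2⟩ := exists_eq_add_I_smul hρ v
  rw [killingForm_conj_apply e1 e2, Complex.add_re]
  have hle : ∀ c, ρ c = c → (killingForm ℂ L c c).re ≤ 0 := fun c hc => by
    by_cases h : c = 0
    · simp [h]
    · exact (hneg c hc h).le
  by_cases h : a = 0
  · have hb0 : b ≠ 0 := by
      rintro rfl
      exact hv (by rw [e1, h]; simp)
    linarith [hneg b hb hb0, hle a ha]
  · linarith [hneg a ha h, hle b hb]

section Split
variable {τ : L →ₛₗ[starRingEnd ℂ] L} (hτ : ∀ v, τ (τ v) = v)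
  (hlie : ∀ v w, τ ⁅v, w⁆ = ⁅τ v, τ w⁆) (hH : ∀ x ∈ H, τ x ∈ H)
  (hreal : ∀ x ∈ H, τ x = x → ∀ c : ℂ, Module.End.HasEigenvalue (ad ℂ L x) c → c.im = 0)

include hreal in
theorem weight_apply_im_eq_zero (α : Weight ℂ H L) {x : H} (hx : τ x = x) : (α x).im = 0 := by
  obtain ⟨v, hv, hv0⟩ := α.exists_ne_zero
  have h : ad ℂ L (x : L) v = α x • v := IsKilling.lie_eq_smul_of_mem_rootSpace hv x
  exact hreal x x.2 hx _ (Module.End.hasEigenvalue_of_hasEigenvector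
    ⟨Module.End.mem_eigenspace_iff.2 h, hv0⟩)

-- The roots are real on the fixed points of `τ` in `H`, so `α(τ h)` is the complex conjugate of
-- `α(h)`. This cancels the conjugation introduced by `τ`, so the root space is preserved rather
-- than sent to another one.
include hτ hlie hH hreal in
theorem conj_mem_rootSpace (α : Weight ℂ H L) {v : L} (hv : v ∈ rootSpace H α) :
    τ v ∈ rootSpace H α := by
  refine LieModule.weightSpace_le_genWeightSpace L (α : H → ℂ) ?_
  rw [LieModule.mem_weightSpace]
  intro h
  obtain ⟨a, ha, b, hb, ta, tb, e1, e2⟩ := mem_cartan_parts hτ hH h.2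
  have h1 : ⁅τ (h : L), v⁆ = α (⟨τ h, hH h h.2⟩ : H) • v :=
    IsKilling.lie_eq_smul_of_mem_rootSpace hv ⟨τ h, hH h h.2⟩
  have h2 : ⁅h, τ v⁆ = starRingEnd ℂ (α (⟨τ h, hH h h.2⟩ : H)) • τ v := by
    rw [← LinearMap.map_smulₛₗ, ← h1, hlie, hτ]
    rfl
  rw [h2]
  congr 1
  have i1 := Complex.conj_eq_iff_im.2 (weight_apply_im_eq_zero hreal α (x := ⟨a, ha⟩) ta)
  have i2 := Complex.conj_eq_iff_im.2 (weight_apply_im_eq_zero hreal α (x := ⟨b, hb⟩) tb)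
  have j1 : h = (⟨a, ha⟩ : H) + Complex.I • (⟨b, hb⟩ : H) := Subtype.ext e1
  have j2 : (⟨τ h, hH h h.2⟩ : H) = (⟨a, ha⟩ : H) - Complex.I • (⟨b, hb⟩ : H) := Subtype.ext e2
  rw [j2, j1]
  have k1 := map_add (Weight.toLinear ℂ H L α) (⟨a, ha⟩ : H) (Complex.I • (⟨b, hb⟩ : H))
  have k2 := map_sub (Weight.toLinear ℂ H L α) (⟨a, ha⟩ : H) (Complex.I • (⟨b, hb⟩ : H))
  rw [map_smul] at k1 k2
  simp only [Weight.toLinear_apply, smul_eq_mul] at k1 k2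
  rw [k1, k2, map_sub, map_mul, i1, i2, Complex.conj_I]
  ring

-- On the Cartan subalgebra `κ(x, x)` is a sum of squares of weights with multiplicities, and these
-- weights take real values at `x`.
include hreal in
theorem killingForm_self_re_nonneg {x : L} (hx : x ∈ H) (htx : τ x = x) :
    0 ≤ (killingForm ℂ L x x).re := by
  have h : killingForm ℂ L x x = traceForm ℂ H L (⟨x, hx⟩ : H) ⟨x, hx⟩ := rfl
  rw [h, traceForm_eq_sum_finrank_nsmul_mul, Complex.re_sum]
  refine Finset.sum_nonneg fun χ _ => ?_
  have := weight_apply_im_eq_zero hreal χ (x := ⟨x, hx⟩) htx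
  rw [Complex.re_nsmul, Complex.mul_re, this]
  exact nsmul_nonneg (by nlinarith [mul_self_nonneg (χ (⟨x, hx⟩ : H)).re]) _

-- The root part is `τ`-stable, isotropic and orthogonal to `H`, so `κ(v, τ v)` depends only on the
-- component of `v` in `H`, where it is a sum of two nonnegative terms.
include hτ hlie hH hreal in
theorem killingForm_conj_re_nonneg {p : Weight ℂ H L → Prop} (hp : ∀ α, p α → α.IsNonZero)
    (hadd : ∀ α β : Weight ℂ H L, p α → p β → (α + β : H → ℂ) ≠ 0) {v : L}
    (hv : v ∈ H.toSubmodule ⊔ rootSum H p) : 0 ≤ (killingForm ℂ L v (τ v)).re := by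
  obtain ⟨h, hh, n, hn, rfl⟩ := Submodule.mem_sup.1 hv
  have hh : h ∈ H := hh
  have htn : τ n ∈ rootSum H p := by
    have : rootSum H p ≤ (rootSum H p).comap τ := rootSum_le fun α hα w hw =>
      rootSpace_le_rootSum hα (conj_mem_rootSpace hτ hlie hH hreal α hw)
    exact this hn
  have z1 := killingForm_eq_zero_of_mem_cartan_of_mem_rootSum hp hh htn
  have z2 := killingForm_eq_zero_of_mem_cartan_of_mem_rootSum hp (hH h hh) hn
  have z3 := killingForm_eq_zero_of_mem_rootSum hadd hn htn
  have hs : killingForm ℂ L n (τ h) = killingForm ℂ L (τ h) n := LieModule.traceForm_comm ℂ L L _ _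
  simp only [map_add, LinearMap.add_apply, z1, z3, hs, z2, add_zero]
  obtain ⟨a, ha, b, hb, ta, tb, e1, e2⟩ := mem_cartan_parts hτ hH hh
  rw [killingForm_conj_apply e1 e2, Complex.add_re]
  exact add_nonneg (killingForm_self_re_nonneg hreal ha ta)
    (killingForm_self_re_nonneg hreal hb tb)

end Split

/-- Positivity for the lexicographic order on `ℂ`. -/
def LexPos (z : ℂ) : Prop := 0 < z.re ∨ z.re = 0 ∧ 0 < z.im

theorem LexPos.add_ne_zero {z w : ℂ} (hz : LexPos z) (hw : LexPos w) : z + w ≠ 0 := by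
  intro h
  have h1 := congrArg Complex.re h
  have h2 := congrArg Complex.im h
  simp only [Complex.add_re, Complex.add_im, Complex.zero_re, Complex.zero_im] at h1 h2
  rcases hz with hz | ⟨hz, hz'⟩ <;> rcases hw with hw | ⟨hw, hw'⟩ <;> linarith

theorem lexPos_or_lexPos_neg {z : ℂ} (hz : z ≠ 0) : LexPos z ∨ LexPos (-z) := by
  simp only [LexPos, Complex.neg_re, Complex.neg_im]
  rcases lt_trichotomy z.re 0 with h | h | h
  · exact Or.inr (Or.inl (by linarith))
  · rcases lt_trichotomy z.im 0 with h' | h' | h'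
    · exact Or.inr (Or.inr ⟨by linarith, by linarith⟩)
    · exact absurd (Complex.ext h h') hz
    · exact Or.inl (Or.inr ⟨h, h'⟩)
  · exact Or.inl (Or.inl h)

/-- The fixed space of the product of a compact and a split conjugation has dimension at most
`(dim 𝔤 - rk 𝔤) / 2`. -/
theorem two_mul_finrank_add_rank_le {ρ τ : L →ₛₗ[starRingEnd ℂ] L} (hρ : ∀ v, ρ (ρ v) = v)
    (hneg : ∀ v, ρ v = v → v ≠ 0 → (killingForm ℂ L v v).re < 0) (hτ : ∀ v, τ (τ v) = v)
    (hlie : ∀ v w, τ ⁅v, w⁆ = ⁅τ v, τ w⁆) (hH : ∀ x ∈ H, τ x ∈ H)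
    (hreal : ∀ x ∈ H, τ x = x → ∀ c : ℂ, Module.End.HasEigenvalue (ad ℂ L x) c → c.im = 0)
    {K : Submodule ℂ L} (hK : ∀ v ∈ K, ρ (τ v) = v) :
    2 * finrank ℂ K + LieAlgebra.rank ℂ L ≤ finrank ℂ L := by
  obtain ⟨x, hx⟩ := exists_forall_weight_ne_zero H
  -- On `K` the two conjugations coincide, so a nonzero common vector would make the same number
  -- both negative and nonnegative.
  have key : ∀ p : Weight ℂ H L → Prop, (∀ α, p α → α.IsNonZero) →
      (∀ α β : Weight ℂ H L, p α → p β → (α + β : H → ℂ) ≠ 0) →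
      finrank ℂ K + finrank ℂ ↥(H.toSubmodule ⊔ rootSum H p) ≤ finrank ℂ L := by
    intro p hp hadd
    refine Submodule.finrank_add_finrank_le_of_disjoint (Submodule.disjoint_def.2 fun v hv hv' => ?_)
    by_contra hv0
    have h1 := killingForm_conj_re_nonneg hτ hlie hH hreal hp hadd hv'
    have h2 := killingForm_conj_re_neg hρ hneg hv0
    have h3 : ρ v = τ v := by
      conv_lhs => rw [← hK v hv]
      rw [hρ]
    rw [h3] at h2
    linarith
  -- The regular element `x` need not be `τ`-fixed, so the `α x` may be non-real; the lexicographic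
  -- order on `ℂ` still splits the roots into two opposite halves.
  let p : Weight ℂ H L → Prop := fun α => LexPos (α x)
  let q : Weight ℂ H L → Prop := fun α => LexPos (-α x)
  have n0 : ¬ LexPos 0 := fun h => h.add_ne_zero h (by simp)
  have h1 := key p (fun α hα h0 => n0 (by
      have : α x = 0 := congrFun h0 x
      rwa [← this]))
    (fun α β hα hβ h => hα.add_ne_zero hβ (congrFun h x))
  have h2 := key q (fun α hα h0 => n0 (by
      have : -α x = 0 := by rw [neg_eq_zero]; exact congrFun h0 x
      rwa [← this]))
    (fun α β hα hβ h => hα.add_ne_zero hβ (by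
      have : α x + β x = 0 := congrFun h x
      linear_combination -this))
  -- The two Borel-type subspaces span everything and both contain `H`, so their dimensions add up
  -- to at least `dim L + dim H`. Adding the two instances of `key` gives the bound.
  have h3 := Submodule.finrank_sup_add_finrank_inf_eq (H.toSubmodule ⊔ rootSum H p)
    (H.toSubmodule ⊔ rootSum H q)
  have h4 : (H.toSubmodule ⊔ rootSum H p) ⊔ (H.toSubmodule ⊔ rootSum H q) = ⊤ := by
    rw [eq_top_iff, ← cartan_sup_rootSum_eq_top (H := H)]
    refine sup_le (le_sup_of_le_left le_sup_left) (rootSum_le fun α hα v hv => ?_)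
    rcases lexPos_or_lexPos_neg (hx α hα) with h | h
    · exact (le_sup_of_le_left (le_sup_of_le_right (rootSpace_le_rootSum (p := p) h)) :
        (rootSpace H α).toSubmodule ≤ _) hv
    · exact (le_sup_of_le_right (le_sup_of_le_right (rootSpace_le_rootSum (p := q) h)) :
        (rootSpace H α).toSubmodule ≤ _) hv
  have h5 : finrank ℂ H ≤ finrank ℂ ↥((H.toSubmodule ⊔ rootSum H p) ⊓
      (H.toSubmodule ⊔ rootSum H q)) :=
    Submodule.finrank_mono (s := H.toSubmodule) (le_inf le_sup_left le_sup_left)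
  rw [h4, finrank_top] at h3
  have := rank_le_finrank_cartan H
  omega

end LieTheory

/-! ### Endomorphisms anticommuting with an involution. -/

section Parity

open Module

variable {V : Type*} [AddCommGroup V] [Module ℂ V] [FiniteDimensional ℂ V]

/-- `T` maps the `-1` eigenspace `Vm` into the `+1` eigenspace `Vp`, and the hypothesis says `dim Vm
- dim Vp ≥ dim ker T`. Rank-nullity for this restriction then leaves no slack: its kernel is all of
`ker T`, and its range is all of `Vp`. -/
theorem odd_endomorphism_of_finrank_le {s T : V →ₗ[ℂ] V} (hs : ∀ v, s (s v) = v)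
    (hsT : ∀ v, s (T v) = -T (s v)) {r : ℕ} (hr : finrank ℂ (LinearMap.ker T) = r)
    (hdim : 2 * finrank ℂ (LinearMap.ker (s - LinearMap.id)) + r ≤ finrank ℂ V) :
    (∀ v, s v = v → T v = 0 → v = 0) ∧ ∀ v, s v = v → ∃ w, T w = v := by
  set Vp := LinearMap.ker (s - LinearMap.id) with hVp
  set Vm := LinearMap.ker (s + LinearMap.id) with hVm
  have memp : ∀ v, v ∈ Vp ↔ s v = v := fun v => by simp [hVp, sub_eq_zero]
  have memm : ∀ v, v ∈ Vm ↔ s v = -v := fun v => by simp [hVm, add_eq_zero_iff_eq_neg]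
  have htop : Vp ⊔ Vm = ⊤ := by
    rw [eq_top_iff]
    intro v _
    refine Submodule.mem_sup.2 ⟨(1 / 2 : ℂ) • (v + s v), ?_, (1 / 2 : ℂ) • (v - s v), ?_, by module⟩
    · rw [memp, map_smul, map_add, hs, add_comm]
    · rw [memm, map_smul, map_sub, hs]; module
  have hsum := Submodule.finrank_add_le_finrank_add_finrank Vp Vm
  rw [htop, finrank_top] at hsum
  have hmap : ∀ v ∈ Vm, T v ∈ Vp := fun v hv => by
    rw [memp, hsT, (memm v).1 hv, map_neg, neg_neg]
  have hrn := LinearMap.finrank_range_add_finrank_ker (T.restrict hmap)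
  have hinj : finrank ℂ (LinearMap.ker (T.restrict hmap)) =
      finrank ℂ ↥((LinearMap.ker (T.restrict hmap)).map Vm.subtype) :=
    (Submodule.finrank_map_subtype_eq _ _).symm
  have hle : (LinearMap.ker (T.restrict hmap)).map Vm.subtype ≤ LinearMap.ker T := by
    rintro _ ⟨v, hv, rfl⟩
    exact congrArg Subtype.val (LinearMap.mem_ker.1 hv)
  have hle' := Submodule.finrank_mono hle
  have hran := Submodule.finrank_le (LinearMap.range (T.restrict hmap))
  constructor
  · intro v hv hTv
    -- The kernel of `T` lies entirely in the `-1` eigenspace, so an invariant vector in it equals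
    -- its own negative.
    have heq := Submodule.eq_of_le_of_finrank_le hle (by omega)
    have : v ∈ (LinearMap.ker (T.restrict hmap)).map Vm.subtype := by
      rw [heq]; exact hTv
    obtain ⟨w, -, rfl⟩ := this
    have hw := (memm _).1 w.2
    have h2 : (w : V) = -w := hv.symm.trans hw
    have h3 : (2 : ℂ) • (w : V) = 0 := by
      rw [two_smul]; nth_rewrite 1 [h2]; simp
    exact (smul_eq_zero.1 h3).resolve_left two_ne_zero
  · intro v hv
    have heq : LinearMap.range (T.restrict hmap) = ⊤ :=
      Submodule.eq_top_of_finrank_eq (by omega)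
    obtain ⟨w, hw⟩ := LinearMap.range_eq_top.1 heq ⟨v, (memp v).2 hv⟩
    exact ⟨w, congrArg Subtype.val hw⟩

end Parity

/-! ### The bound applied to the involution `σ₀` and a principal nilpotent element. -/

section Involution

variable {E : Type*} [NormedAddCommGroup E] [NormedSpace ℂ E] [FiniteDimensional ℂ E]
  [CompleteSpace E] {G : Type*} [TopologicalSpace G] [ChartedSpace E G] [Group G]
  [LieGroup 𝓘(ℂ, E) ω G]

/-- The differential of an antiholomorphic involution, as a conjugate-linear map. -/
def IsAntiholomorphicInvolution.conj {f : G ≃* G} (hf : IsAntiholomorphicInvolution E f) :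
    LieAlg E G →ₛₗ[starRingEnd ℂ] LieAlg E G where
  toFun := differential E f
  map_add' := map_add _
  map_smul' c v := by
    have hc : ∀ (c : ℂ) (w : LieAlg E G), c • w = c.re • w + c.im • Complex.I • w := by
      intro c w
      conv_lhs => rw [← Complex.re_add_im c]
      rw [add_smul, mul_smul]
      rfl
    rw [hc, map_add, map_smul, map_smul, hf.differential_I, hc (starRingEnd ℂ c), Complex.conj_re,
      Complex.conj_im, smul_neg, neg_smul]

omit [FiniteDimensional ℂ E] [CompleteSpace E] [LieGroup 𝓘(ℂ, E) ω G] in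
theorem IsAntiholomorphicInvolution.conj_conj {f : G ≃* G}
    (hf : IsAntiholomorphicInvolution E f) (v : LieAlg E G) : hf.conj (hf.conj v) = v := by
  have h2 := differential_comp (E := E) f f hf.smooth hf.smooth v
  have h3 : f.trans f = MulEquiv.refl G := by ext g; exact hf.involutive g
  refine h2.symm.trans ?_
  rw [h3]
  exact congrArg (fun L : E →L[ℝ] E => L v) (mfderiv_id (I := 𝓘(ℝ, E)) (x := (1 : G)))

omit [FiniteDimensional ℂ E] in
theorem IsAntiholomorphicInvolution.conj_lie {f : G ≃* G}
    (hf : IsAntiholomorphicInvolution E f) (v w : LieAlg E G) :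
    hf.conj ⁅v, w⁆ = ⁅hf.conj v, hf.conj w⁆ := by
  refine differential_lie f hf.smooth ?_ v w
  have : f.symm = f := by
    ext g
    rw [MulEquiv.symm_apply_eq, hf.involutive]
  rw [this]
  exact hf.smooth

omit [FiniteDimensional ℂ E] in
theorem RealForms.dsigma_eq (R : RealForms E G) (v : LieAlg E G) :
    R.dsigma v = R.compact.1.conj (R.split.1.conj v) :=
  differential_comp _ _ R.compact.1.smooth R.split.1.smooth v

omit [FiniteDimensional ℂ E] in
theorem RealForms.dsigma_dsigma (R : RealForms E G) (v : LieAlg E G) :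
    R.dsigma (R.dsigma v) = v := by
  have h2 := differential_comp (E := E) R.sigma R.sigma R.contMDiff_sigma R.contMDiff_sigma v
  have h3 : R.sigma.trans R.sigma = MulEquiv.refl G := by ext g; exact R.sigma_sigma g
  refine h2.symm.trans ?_
  rw [h3]
  exact congrArg (fun L : E →L[ℝ] E => L v) (mfderiv_id (I := 𝓘(ℝ, E)) (x := (1 : G)))

variable [LieAlgebra.IsSimple ℂ (LieAlg E G)]

theorem RealForms.two_mul_finrank_ker_add_rank_le (R : RealForms E G) :
    2 * Module.finrank ℂ (LinearMap.ker (R.dsigma - LinearMap.id)) +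
      LieAlgebra.rank ℂ (LieAlg E G) ≤ Module.finrank ℂ (LieAlg E G) := by
  obtain ⟨H, hC, hH, hreal⟩ := R.split.2
  refine two_mul_finrank_add_rank_le (H := H) R.compact.1.conj_conj R.compact.2
    R.split.1.conj_conj R.split.1.conj_lie hH hreal fun v hv => ?_
  rw [← R.dsigma_eq]
  exact sub_eq_zero.1 hv

theorem RealForms.principal_nilpotent_odd (R : RealForms E G) {z : LieAlg E G}
    (hz : IsPrincipalNilpotent z) (hs : R.dsigma z = -z) :
    (∀ v, R.dsigma v = v → ⁅z, v⁆ = 0 → v = 0) ∧ ∀ v, R.dsigma v = v → ∃ w, ⁅z, w⁆ = v :=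
  odd_endomorphism_of_finrank_le (s := R.dsigma) (T := LieAlgebra.ad ℂ (LieAlg E G) z)
    R.dsigma_dsigma (fun v => by
      change R.dsigma ⁅z, v⁆ = -⁅z, R.dsigma v⁆
      rw [R.dsigma_lie, hs, neg_lie]) hz.2 R.two_mul_finrank_ker_add_rank_le

end Involution

/-! ### Fibres of the adjoint bundle. -/

section Fibre

variable {E G F S P : Type*}
  [NormedAddCommGroup E] [NormedSpace ℂ E] [CompleteSpace E]
  [TopologicalSpace G] [ChartedSpace E G] [Group G] [LieGroup 𝓘(ℂ, E) ω G]
  [TopologicalSpace S] [ChartedSpace Plane S]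
  [NormedAddCommGroup F] [NormedSpace ℝ F] [TopologicalSpace P] [ChartedSpace F P]
  {B : PrincipalBundle E G F S P} {x : S}

omit [CompleteSpace E] [LieGroup 𝓘(ℂ, E) ω G] in
theorem PrincipalBundle.Fiber.exists_act_eq (p q : B.Fiber x) : ∃ g, p.act g = q := by
  obtain ⟨U, s, t, -, hx, -, -, -, -, h⟩ := B.locally_trivial x
  have hp := h p.1 (by rw [Set.mem_preimage, p.2]; exact hx)
  have hq := h q.1 (by rw [Set.mem_preimage, q.2]; exact hx)
  rw [p.2] at hp
  rw [q.2] at hq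
  refine ⟨(t p.1)⁻¹ * t q.1, Subtype.ext ?_⟩
  calc B.act p.1 _ = B.act (B.act (s x) (t p.1)) _ := by rw [hp]
    _ = q.1 := by rw [← B.act_mul, mul_inv_cancel_left, hq]

omit [CompleteSpace E] in
theorem PrincipalBundle.AdjFiber.eq_zero_of_apply {f : B.AdjFiber x} {p : B.Fiber x}
    (h : f.1 p = 0) : f = 0 := by
  refine Subtype.ext (funext fun q => ?_)
  obtain ⟨g, rfl⟩ := p.exists_act_eq q
  rw [f.2 p g, h, map_zero]
  rfl

/-- Evaluation at a `σ`-fixed point of the fibre turns the involution of `𝔤_P` into the differential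
of `σ₀`, which is how the algebra of `𝔤` applies to the bundle. -/
theorem SigmaStructure.exists_fixed_fiber {R : RealForms E G} (s : SigmaStructure R B) (x : S) :
    ∃ p : B.Fiber x, ∀ f : B.AdjFiber x, (s.adj x f).1 p = R.dsigma (f.1 p) := by
  obtain ⟨p, hp, hs⟩ := s.exists_fixed x
  refine ⟨⟨p, hp⟩, fun f => ?_⟩
  have : s.fiber (⟨p, hp⟩ : B.Fiber x) = ⟨p, hp⟩ := Subtype.ext hs
  change R.dsigma (f.1 (s.fiber _)) = _
  rw [this]

end Fibre

/-! ### Pointwise equations for the Fock field. -/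

namespace FockBundle

variable {E G F S P : Type*}
  [NormedAddCommGroup E] [NormedSpace ℂ E] [FiniteDimensional ℂ E] [CompleteSpace E]
  [TopologicalSpace G] [ChartedSpace E G] [Group G] [LieGroup 𝓘(ℂ, E) ω G]
  [TopologicalSpace S] [ChartedSpace Plane S] [IsManifold (𝓡 2) ∞ S]
  [NormedAddCommGroup F] [NormedSpace ℝ F] [TopologicalSpace P] [ChartedSpace F P]
  {R : RealForms E G} (B : FockBundle E G F S P R)

/-- The value of the Fock field on a tangent vector. -/
def field (x : S) (v : TangentSpace (𝓡 2) x) : B.bundle.AdjFiber x := B.Phi.1 x fun _ => v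

theorem adj_field (x : S) (v : TangentSpace (𝓡 2) x) :
    B.sigma.adj x (B.field x v) = -B.field x v := by
  have h := congrArg (fun w : B.bundle.AdjForm 1 => w.1 x fun _ => v) B.sigma_Phi
  exact h

theorem wedgeBracket_zero_apply (w : B.bundle.PreForm 0) (x : S)
    (v : Fin 1 → TangentSpace (𝓡 2) x) :
    B.Phi.1.wedgeBracket w x v = ⁅B.field x (v 0), w x Fin.elim0⁆ := by
  refine (PrincipalBundle.PreForm.wedgeBracket_apply B.Phi.1 w x v).trans ?_
  rw [Fin.sum_univ_one]
  simp only [Fin.val_zero, pow_zero, one_smul]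
  congr 2
  exact Subsingleton.elim _ _

theorem wedgeBracket_one_apply (w : B.bundle.PreForm 1) (x : S) (v : Fin 2 → TangentSpace (𝓡 2) x) :
    B.Phi.1.wedgeBracket w x v =
      ⁅B.field x (v 0), w x fun _ => v 1⁆ - ⁅B.field x (v 1), w x fun _ => v 0⁆ := by
  refine (PrincipalBundle.PreForm.wedgeBracket_apply B.Phi.1 w x v).trans ?_
  rw [Fin.sum_univ_two]
  have h0 : Fin.removeNth 0 v = fun _ => v 1 := by
    funext i; fin_cases i; rfl
  have h1 : Fin.removeNth 1 v = fun _ => v 0 := by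
    funext i; fin_cases i; rfl
  rw [h0, h1]
  simp only [Fin.val_zero, pow_zero, one_smul, Fin.val_one, pow_one, neg_smul, sub_eq_add_neg]
  rfl

theorem lie_field_field (x : S) (v w : TangentSpace (𝓡 2) x) :
    ⁅B.field x v, B.field x w⁆ = 0 := by
  have h := congrArg (fun u : B.bundle.AdjForm 2 => u.1 x ![v, w]) B.wedge_self
  have h' : ⁅B.field x v, B.field x w⁆ - ⁅B.field x w, B.field x v⁆ = 0 :=
    (B.wedgeBracket_one_apply B.Phi.1 x ![v, w]).symm.trans h
  rw [← lie_skew (B.field x w), sub_neg_eq_add, ← two_smul ℂ] at h'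
  exact (smul_eq_zero.1 h').resolve_left two_ne_zero

variable [LieAlgebra.IsSimple ℂ (LieAlg E G)] {B} {x : S} {v : TangentSpace (𝓡 2) x}

theorem eq_zero_of_lie_field_eq_zero (hv : v ≠ 0) {f : B.bundle.AdjFiber x}
    (hf : B.sigma.adj x f = f) (h : ⁅B.field x v, f⁆ = 0) : f = 0 := by
  obtain ⟨p, hp⟩ := B.sigma.exists_fixed_fiber x
  refine PrincipalBundle.AdjFiber.eq_zero_of_apply (p := p) ?_
  refine (R.principal_nilpotent_odd (B.principal_nilpotent x v hv p) ?_).1 _ ?_ ?_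
  · exact (hp _).symm.trans (congrArg (fun f : B.bundle.AdjFiber x => f.1 p) (B.adj_field x v))
  · rw [← hp, hf]
  · exact congrArg (fun f : B.bundle.AdjFiber x => f.1 p) h

/-- Solvability holds at a `σ`-fixed point of the fibre and is carried by equivariance to an
arbitrary point `q`. The freedom in `q` matters because a local section of `P` need not be
`σ`-fixed. -/
theorem exists_lie_field_apply_eq (hv : v ≠ 0) {f : B.bundle.AdjFiber x}
    (hf : B.sigma.adj x f = f) (q : B.bundle.Fiber x) :
    ∃ w : LieAlg E G, ⁅(B.field x v).1 q, w⁆ = f.1 q := by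
  obtain ⟨p, hp⟩ := B.sigma.exists_fixed_fiber x
  obtain ⟨w, hw⟩ := (R.principal_nilpotent_odd (B.principal_nilpotent x v hv p)
    ((hp _).symm.trans (congrArg (fun f : B.bundle.AdjFiber x => f.1 p) (B.adj_field x v)))).2
    (f.1 p) (by rw [← hp, hf])
  obtain ⟨g, rfl⟩ := p.exists_act_eq q
  refine ⟨Ad g⁻¹ w, ?_⟩
  rw [(B.field x v).2, f.2, ← hw, Ad_lie]
  rfl

/-- The sum of `f` and its image under `σ` is invariant and commutes with `Φ(v)`, so injectivity on
invariants kills it. -/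
theorem adj_eq_neg_of_adj_lie_field (hv : v ≠ 0) {f : B.bundle.AdjFiber x}
    (h : B.sigma.adj x ⁅B.field x v, f⁆ = ⁅B.field x v, f⁆) : B.sigma.adj x f = -f := by
  rw [B.sigma.adj_lie, B.adj_field, neg_lie] at h
  rw [eq_neg_iff_add_eq_zero]
  refine eq_zero_of_lie_field_eq_zero hv ?_ ?_
  · rw [map_add, B.sigma.adj_adj, add_comm]
  · rw [lie_add, ← h, add_neg_cancel]

/-- A solution of `[Φ(v), f] = a` with `a` invariant solves `[Φ(w), f] = b` for each invariant `b`
with `[Φ(v), b] = [Φ(w), a]`. -/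
theorem lie_field_eq_of_lie_field_eq (hv : v ≠ 0) {w : TangentSpace (𝓡 2) x}
    {f a b : B.bundle.AdjFiber x} (ha : B.sigma.adj x a = a) (hb : B.sigma.adj x b = b)
    (hab : ⁅B.field x v, b⁆ = ⁅B.field x w, a⁆) (hf : ⁅B.field x v, f⁆ = a) :
    ⁅B.field x w, f⁆ = b := by
  have hneg := adj_eq_neg_of_adj_lie_field hv (f := f) (by rw [hf, ha])
  -- The defect is invariant, since both `Φ(w)` and `f` change sign under `σ`. It commutes with
  -- `Φ(v)` by the Jacobi identity and `[Φ(v), Φ(w)] = 0`, so it vanishes.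
  refine (sub_eq_zero.1 (eq_zero_of_lie_field_eq_zero hv (f := b - ⁅B.field x w, f⁆) ?_ ?_)).symm
  · rw [map_sub, hb, B.sigma.adj_lie, B.adj_field, hneg, neg_lie, lie_neg, neg_neg]
  · rw [lie_sub, hab, leibniz_lie (B.field x v), lie_field_field, zero_lie, zero_add, hf, sub_self]

end FockBundle

/-! ### Smooth generalized inverses of endomorphisms of constant rank. -/

section GeneralizedInverse

open Module

variable {V : Type*} [NormedAddCommGroup V] [NormedSpace ℝ V] [FiniteDimensional ℝ V]

theorem exists_generalized_inverse (T : V →L[ℝ] V) :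
    ∃ R : V →L[ℝ] V, ∀ v, T (R (T v)) = T v := by
  obtain ⟨g, hg⟩ := T.toLinearMap.rangeRestrict.exists_rightInverse_of_surjective
    (LinearMap.range_rangeRestrict _)
  obtain ⟨r, hr⟩ := LinearMap.exists_extend g
  refine ⟨LinearMap.toContinuousLinearMap r, fun v => ?_⟩
  have h1 : r (T v) = g (T.toLinearMap.rangeRestrict v) :=
    LinearMap.congr_fun hr (T.toLinearMap.rangeRestrict v)
  have h2 := congrArg Subtype.val (LinearMap.congr_fun hg (T.toLinearMap.rangeRestrict v))
  change T (r (T v)) = T v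
  rw [h1]
  exact h2

/-- Near an endomorphism `T₀`, the endomorphisms whose kernel has the same dimension have
generalized inverses that depend smoothly on the endomorphism. -/
theorem exists_contDiffOn_generalized_inverse (T₀ : V →L[ℝ] V) :
    ∃ (N : Set (V →L[ℝ] V)) (L : (V →L[ℝ] V) → V →L[ℝ] V), IsOpen N ∧ T₀ ∈ N ∧
      ContDiffOn ℝ ∞ L N ∧ ∀ T ∈ N,
        finrank ℝ (LinearMap.ker T.toLinearMap) = finrank ℝ (LinearMap.ker T₀.toLinearMap) →
          ∀ v, T (L T (T v)) = T v := by
  have : CompleteSpace V := FiniteDimensional.complete ℝ V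
  obtain ⟨R, hR⟩ := exists_generalized_inverse T₀
  -- A correction equal to the identity at `T₀`, hence invertible nearby, chosen so that it carries
  -- `ker T` into `ker T₀`. The generalized inverse of `T` will be `(M T)⁻¹ R`.
  let M : (V →L[ℝ] V) → V →L[ℝ] V := fun T => 1 + R * (T - T₀)
  have hM : ContDiff ℝ ∞ M :=
    contDiff_const.add (contDiff_const.mul (contDiff_id.sub contDiff_const))
  refine ⟨M ⁻¹' {A | IsUnit A}, fun T => Ring.inverse (M T) * R,
    Units.isOpen.preimage hM.continuous, ?_, ?_, ?_⟩
  · simp [M]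
  · intro T hT
    obtain ⟨u, hu⟩ := hT
    have h1 : ContDiffAt ℝ ∞ Ring.inverse (M T) := hu ▸ contDiffAt_ringInverse ℝ u
    exact ((h1.comp T hM.contDiffAt).mul contDiffAt_const).contDiffWithinAt
  · intro T hT hdim v
    have hl : ∀ w, Ring.inverse (M T) (M T w) = w := fun w =>
      congrArg (fun A : V →L[ℝ] V => A w) (Ring.inverse_mul_cancel _ hT)
    have hMT : ∀ w, M T w = w + R (T w) - R (T₀ w) := fun w => by
      change w + R (T w - T₀ w) = _
      rw [map_sub, add_sub_assoc]
    have hinj : Function.Injective (M T).toLinearMap := Function.LeftInverse.injective hl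
    -- For `w` in `ker T` one has `M T w = w - R (T₀ w)`, which `T₀` kills. Equality of the kernel
    -- dimensions makes this inclusion an equality.
    have hker : (LinearMap.ker T.toLinearMap).map (M T).toLinearMap =
        LinearMap.ker T₀.toLinearMap := by
      refine Submodule.eq_of_le_of_finrank_eq ?_ ?_
      · rintro _ ⟨w, hw, rfl⟩
        have hw : T w = 0 := hw
        change T₀ (M T w) = 0
        rw [hMT, hw, map_zero, add_zero, map_sub, hR, sub_self]
      · rw [← hdim]
        exact (Submodule.equivMapOfInjective _ hinj _).finrank_eq.symm
    have hmem : v - R (T₀ v) ∈ LinearMap.ker T₀.toLinearMap := by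
      change T₀ (v - R (T₀ v)) = 0
      rw [map_sub, hR, sub_self]
    rw [← hker] at hmem
    obtain ⟨w, hw, hw'⟩ := hmem
    have hw : T w = 0 := hw
    have hw' : M T w = v - R (T₀ v) := hw'
    -- Applying `(M T)⁻¹` therefore gives `v - w` with `w` in `ker T`, and `T` sends this back to `T
    -- v`.
    have h2 : R (T v) = M T (v - w) := by
      rw [map_sub, hw', hMT]
      abel
    change T (Ring.inverse (M T) (R (T v))) = T v
    rw [h2, hl, map_sub, hw, sub_zero]

end GeneralizedInverse

/-! ### Smoothness of the adjoint action, local frames and contraction of forms. -/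

section Adjoint

variable {E : Type*} [NormedAddCommGroup E] [NormedSpace ℂ E] [FiniteDimensional ℂ E]
  {G : Type*} [TopologicalSpace G] [ChartedSpace E G] [Group G] [LieGroup 𝓘(ℂ, E) ω G]

/-- The adjoint action, with values in the continuous endomorphisms of the model space. -/
def AdCLM (g : G) : E →L[ℝ] E := realDeriv (E := E) (MulAut.conj g : G ≃* G) (1 : G)

-- `Ad` is the partial derivative at `x = 1` of the smooth map `(g, x) ↦ g x g⁻¹`. Conjugation fixes
-- `1`, so both base points are constant and the tangent coordinate changes are trivial.
omit [FiniteDimensional ℂ E] in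
theorem contMDiff_AdCLM :
    ContMDiff 𝓘(ℝ, E) 𝓘(ℝ, E →L[ℝ] E) ∞ (AdCLM : G → E →L[ℝ] E) := by
  have hL : LieGroup 𝓘(ℝ, E) ω G := lieGroup_real
  have hL' : LieGroup 𝓘(ℝ, E) ∞ G := LieGroup.of_le (n := ω) le_top
  intro g₀
  have hf : ContMDiff (𝓘(ℝ, E).prod 𝓘(ℝ, E)) 𝓘(ℝ, E) ∞
      (Function.uncurry fun g x : G => g * x * g⁻¹) :=
    (contMDiff_fst.mul contMDiff_snd).mul contMDiff_fst.inv
  have h := ContMDiffAt.mfderiv (I := 𝓘(ℝ, E)) (I' := 𝓘(ℝ, E)) (J := 𝓘(ℝ, E)) (x₀ := g₀)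
    (m := ∞) (n := ∞)
    (fun g x : G => g * x * g⁻¹) (fun _ => (1 : G)) hf.contMDiffAt contMDiffAt_const (by simp)
  have e : (fun g : G => g * 1 * g⁻¹) = fun _ => (1 : G) := by
    funext g
    rw [mul_one, mul_inv_cancel]
  have he := congrArg (fun q : G → G => inTangentCoordinates 𝓘(ℝ, E) 𝓘(ℝ, E) (fun _ => (1 : G)) q
    (AdCLM : G → E →L[ℝ] E) g₀) e
  have hc : ∀ v : E, (tangentBundleCore 𝓘(ℝ, E) G).coordChange (achart E (1 : G))
      (achart E (1 : G)) 1 v = v := fun v =>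
    (tangentBundleCore 𝓘(ℝ, E) G).coordChange_self _ _ (mem_chart_source E (1 : G)) v
  have h' : inTangentCoordinates 𝓘(ℝ, E) 𝓘(ℝ, E) (fun _ => (1 : G)) (fun _ => (1 : G))
      (AdCLM : G → E →L[ℝ] E) g₀ = AdCLM := by
    funext g
    refine (inTangentCoordinates_eq (I := 𝓘(ℝ, E)) (I' := 𝓘(ℝ, E)) (fun _ : G => (1 : G))
      (fun _ => (1 : G)) AdCLM (x₀ := g₀) (x := g) (mem_chart_source E (1 : G))
      (mem_chart_source E (1 : G))).trans ?_
    ext v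
    change (tangentBundleCore 𝓘(ℝ, E) G).coordChange (achart E (1 : G)) (achart E (1 : G)) 1
      (AdCLM g ((tangentBundleCore 𝓘(ℝ, E) G).coordChange (achart E (1 : G))
        (achart E (1 : G)) 1 v)) = AdCLM g v
    rw [hc, hc]
  exact (he.trans h') ▸ h

end Adjoint

section LocalFrame

variable {S : Type*} [TopologicalSpace S] [ChartedSpace Plane S] [IsManifold (𝓡 2) ∞ S]

theorem exists_smooth_field_ne_zero (x₀ : S) :
    ∃ (U : Set S) (V : ∀ x : S, TangentSpace (𝓡 2) x), IsOpen U ∧ x₀ ∈ U ∧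
      IsSmoothFieldOn V U ∧ ∀ x ∈ U, V x ≠ 0 := by
  have : IsManifold (𝓡 2) (∞ + 1) S := by
    have h : (∞ + 1 : ℕ∞ω) = ∞ := by rfl
    rw [h]
    infer_instance
  let e := trivializationAt Plane (TangentSpace (𝓡 2) : S → Type) x₀
  let b := (EuclideanSpace.basisFun (Fin 2) ℝ).toBasis
  have h := e.isLocalFrameOn_localFrame_baseSet (𝓡 2) ∞ b
  exact ⟨e.baseSet, e.localFrame b 0, e.open_baseSet,
    FiberBundle.mem_baseSet_trivializationAt' x₀, h.contMDiffOn 0,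
    fun x hx => (h.linearIndependent hx).ne_zero 0⟩

end LocalFrame

section AdOne

variable {E : Type*} [NormedAddCommGroup E] [NormedSpace ℂ E]
  {G : Type*} [TopologicalSpace G] [ChartedSpace E G] [Group G]

theorem AdCLM_one (v : E) : AdCLM (1 : G) v = v := by
  have h : (MulAut.conj (1 : G) : G → G) = id := by
    funext g
    simp
  have h' : AdCLM (E := E) (1 : G) = realDeriv (E := E) (id : G → G) 1 :=
    congrArg (fun f : G → G => realDeriv (E := E) f 1) h
  rw [h']
  exact congrArg (fun L : E →L[ℝ] E => L v) (mfderiv_id (I := 𝓘(ℝ, E)) (x := (1 : G)))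

theorem AdCLM_mul_inv [LieGroup 𝓘(ℂ, E) ω G] (g h : G) (v : E) :
    AdCLM (g * h)⁻¹ v = AdCLM h⁻¹ (AdCLM g⁻¹ v) := by
  have hc : ∀ g : G, ContMDiff 𝓘(ℝ, E) 𝓘(ℝ, E) ∞ (MulAut.conj g : G ≃* G) := fun g =>
    (contMDiff_real (contMDiff_conj g)).of_le le_top
  have h1 := differential_comp (E := E) _ _ (hc h⁻¹) (hc g⁻¹) v
  refine Eq.trans ?_ h1
  have h2 : (MulAut.conj g⁻¹ : G ≃* G).trans (MulAut.conj h⁻¹) = MulAut.conj (g * h)⁻¹ := by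
    ext x
    simp [mul_assoc]
  rw [h2]
  rfl

end AdOne

section Bundle

variable {E G F S P : Type*}
  [NormedAddCommGroup E] [NormedSpace ℂ E]
  [TopologicalSpace G] [ChartedSpace E G] [Group G]
  [TopologicalSpace S] [ChartedSpace Plane S]
  [NormedAddCommGroup F] [NormedSpace ℝ F] [TopologicalSpace P] [ChartedSpace F P]
  {B : PrincipalBundle E G F S P}

section
variable [CompleteSpace E] [LieGroup 𝓘(ℂ, E) ω G]

/-- The contraction of a form with a vector field, followed by a field of endomorphisms of the
adjoint bundle. -/
def PrincipalBundle.PreForm.contract (V : ∀ x : S, TangentSpace (𝓡 2) x)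
    (T : ∀ x : S, B.AdjFiber x →ₗ[ℝ] B.AdjFiber x) {k : ℕ} (w : B.PreForm (k + 1)) :
    B.PreForm k :=
  fun x => (T x).compAlternatingMap ((w x).curryLeft (V x))

omit [CompleteSpace E] in
theorem PrincipalBundle.PreForm.contract_apply (V : ∀ x : S, TangentSpace (𝓡 2) x)
    (T : ∀ x : S, B.AdjFiber x →ₗ[ℝ] B.AdjFiber x) {k : ℕ} (w : B.PreForm (k + 1)) (x : S)
    (v : Fin k → TangentSpace (𝓡 2) x) :
    w.contract V T x v = T x (w x (Matrix.vecCons (V x) v)) := rfl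

/-- The endomorphism of the fibre of the adjoint bundle at `x` given by a real endomorphism of `𝔤`
in terms of a trivialization of the fibre of `P` with base point `q`. -/
def PrincipalBundle.adjEnd {x : S} (q : B.Fiber x) (t : B.Fiber x → G)
    (ht : ∀ p g, t (p.act g) = t p * g) (A : E →L[ℝ] E) :
    B.AdjFiber x →ₗ[ℝ] B.AdjFiber x where
  toFun f := ⟨fun p => AdCLM (E := E) (t p)⁻¹ (A (f.1 q)), fun p g =>
    (congrArg (fun h => AdCLM (E := E) h⁻¹ (A (f.1 q))) (ht p g)).trans (AdCLM_mul_inv _ _ _)⟩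
  map_add' f f' := Subtype.ext (funext fun p =>
    map_add ((AdCLM (E := E) (t p)⁻¹).comp A) (f.1 q) (f'.1 q))
  map_smul' c f := Subtype.ext (funext fun p =>
    map_smul ((AdCLM (E := E) (t p)⁻¹).comp A) c (f.1 q))

end

end Bundle

/-! ### Local homotopy operators. -/

namespace FockBundle

variable {E G F S P : Type*}
  [NormedAddCommGroup E] [NormedSpace ℂ E] [FiniteDimensional ℂ E] [CompleteSpace E]
  [TopologicalSpace G] [ChartedSpace E G] [Group G] [LieGroup 𝓘(ℂ, E) ω G]
  [TopologicalSpace S] [ChartedSpace Plane S] [IsManifold (𝓡 2) ∞ S]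
  [NormedAddCommGroup F] [NormedSpace ℝ F] [TopologicalSpace P] [ChartedSpace F P]
  {R : RealForms E G} (B : FockBundle E G F S P R)

/-- A homotopy operator over an open subset `U` of `S`: contraction with a vector field `V` without
zeros, followed by a smooth generalized inverse of `ad_{Φ(V)}`. -/
structure LocalHomotopy (U : Set S) where
  /-- The vector field. -/
  V : ∀ x : S, TangentSpace (𝓡 2) x
  /-- The generalized inverse of `ad_{Φ(V)}`. -/
  op : ∀ x : S, B.bundle.AdjFiber x →ₗ[ℝ] B.bundle.AdjFiber x
  ne_zero : ∀ x ∈ U, V x ≠ 0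
  lie_op : ∀ x ∈ U, ∀ f : B.bundle.AdjFiber x,
    (∀ p, ∃ w, ⁅(B.field x (V x)).1 p, w⁆ = f.1 p) → ⁅B.field x (V x), op x f⁆ = f
  smooth : ∀ (k : ℕ) (w : B.bundle.AdjForm (k + 1)) (W : Set S)
    (X : Fin k → ∀ x : S, TangentSpace (𝓡 2) x), IsOpen W → (∀ i, IsSmoothFieldOn (X i) W) →
      ContMDiffOn 𝓘(ℝ, F) 𝓘(ℝ, E) ∞ (PrincipalBundle.PreForm.eval (w.1.contract V op) X)
        (B.bundle.proj ⁻¹' (U ∩ W))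

/-- This supplies the constant-rank hypothesis for the generalized inverse. The factor 2 passes from
complex to real dimension. -/
theorem finrank_ker_bracketCLM {z : LieAlg E G} (hz : IsPrincipalNilpotent z) :
    Module.finrank ℝ (LinearMap.ker (bracketCLM E G z).toLinearMap) =
      2 * LieAlgebra.rank ℂ (LieAlg E G) := by
  rw [← hz.2, ← finrank_real_of_complex]
  rfl

/-- A local section of `P` turns `ad Φ(V)` into a smooth family of endomorphisms of the fixed space
`E` with kernels of constant dimension. Its smooth generalized inverse is spread over each fibre of
`P` by equivariance. -/
theorem exists_localHomotopy (x₀ : S) :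
    ∃ U : Set S, IsOpen U ∧ x₀ ∈ U ∧ Nonempty (B.LocalHomotopy U) := by
  have : FiniteDimensional ℝ E := FiniteDimensional.complexToReal E
  obtain ⟨U₁, V, hU₁, hx₁, hV, hV0⟩ := exists_smooth_field_ne_zero x₀
  obtain ⟨U₂, s, t, hU₂, hx₂, hs, ht, hps, hts, hst⟩ := B.bundle.locally_trivial x₀
  let T : S → E →L[ℝ] E := fun y => bracketCLM E G (B.Phi.1.eval (fun _ => V) (s y))
  have hmaps : ∀ W : Set S, Set.MapsTo s (U₂ ∩ W) (B.bundle.proj ⁻¹' W) := fun W y hy => by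
    rw [Set.mem_preimage, hps y hy.1]
    exact hy.2
  have hT : ContMDiffOn (𝓡 2) 𝓘(ℝ, E →L[ℝ] E) ∞ T (U₂ ∩ U₁) :=
    (bracketCLM E G).contDiff.contMDiff.comp_contMDiffOn
      ((B.Phi.2 U₁ (fun _ => V) hU₁ fun _ => hV).comp (hs.mono Set.inter_subset_left) (hmaps U₁))
  obtain ⟨N, L, hN, hTN, hL, hinv⟩ := exists_contDiffOn_generalized_inverse (T x₀)
  let U := (U₂ ∩ U₁) ∩ T ⁻¹' N
  have hU : IsOpen U := hT.continuousOn.isOpen_inter_preimage (hU₂.inter hU₁) hN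
  have hLT : ContMDiffOn (𝓡 2) 𝓘(ℝ, E →L[ℝ] E) ∞ (fun y => L (T y)) U :=
    hL.contMDiffOn.comp (hT.mono Set.inter_subset_left) fun y hy => hy.2
  have htact : ∀ {x : S} (hx : x ∈ U₂) (p : B.bundle.Fiber x) (g : G),
      t (p.act g).1 = t p.1 * g := fun {x} hx p g => by
    have h1 := hst p.1 (by rw [Set.mem_preimage, p.2]; exact hx)
    have h2 : (p.act g).1 = B.bundle.act (s (B.bundle.proj p.1)) (t p.1 * g) := by
      rw [B.bundle.act_mul, h1]
      rfl
    rw [h2, hts _ (by rw [p.2]; exact hx)]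
  have hdim : ∀ y ∈ U, Module.finrank ℝ (LinearMap.ker (T y).toLinearMap) =
      2 * LieAlgebra.rank ℂ (LieAlg E G) := fun y hy =>
    finrank_ker_bracketCLM (B.principal_nilpotent _ _ (hV0 _ (by rw [hps y hy.1.1]; exact hy.1.2))
      ⟨s y, rfl⟩)
  have hxU : x₀ ∈ U := ⟨⟨hx₂, hx₁⟩, hTN⟩
  classical
  -- The value 0 off the trivializing set is a default that is never used over `U`.
  let op : ∀ x : S, B.bundle.AdjFiber x →ₗ[ℝ] B.bundle.AdjFiber x := fun x =>
    if hx : x ∈ U₂ then PrincipalBundle.adjEnd ⟨s x, hps x hx⟩ (fun p => t p.1) (htact hx) (L (T x))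
    else 0
  have hop : ∀ (x : S) (hx : x ∈ U₂) (f : B.bundle.AdjFiber x) (p : B.bundle.Fiber x),
      (op x f).1 p = AdCLM (t p.1)⁻¹ (L (T x) (f.1 ⟨s x, hps x hx⟩)) := fun x hx f p => by
    simp only [op, dif_pos hx]
    rfl
  refine ⟨U, hU, hxU, ⟨⟨V, op, fun x hx => hV0 x hx.1.2, ?_, ?_⟩⟩⟩
  · intro x hx f hf
    refine sub_eq_zero.1 (PrincipalBundle.AdjFiber.eq_zero_of_apply
      (p := ⟨s x, hps x hx.1.1⟩) ?_)
    obtain ⟨w, hw⟩ := hf ⟨s x, hps x hx.1.1⟩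
    have hTx : ∀ u : E, T x u =
        (⁅(B.field x (V x)).1 ⟨s x, hps x hx.1.1⟩, (u : LieAlg E G)⁆ : LieAlg E G) := by
      intro u
      have := PrincipalBundle.PreForm.eval_fiber B.Phi.1 (fun _ => V) ⟨s x, hps x hx.1.1⟩
      change bracketCLM E G (B.Phi.1.eval (fun _ => V) (s x)) u = _
      rw [← this]
      rfl
    have ht1 : t (s x) = 1 := by
      have := hts x hx.1.1 1
      rwa [B.bundle.act_one] at this
    have h1 : (op x f).1 ⟨s x, hps x hx.1.1⟩ = L (T x) (T x w) := by
      rw [hop x hx.1.1, ht1, inv_one, AdCLM_one, ← hw]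
      exact congrArg (L (T x)) (hTx w).symm
    have h2 := hinv (T x) hx.2 ((hdim x hx).trans (hdim x₀ hxU).symm) w
    have h3 : ⁅(B.field x (V x)).1 ⟨s x, hps x hx.1.1⟩, (op x f).1 ⟨s x, hps x hx.1.1⟩⁆ =
        f.1 ⟨s x, hps x hx.1.1⟩ := by
      rw [h1, ← hw]
      exact (hTx _).symm.trans (h2.trans (hTx w))
    exact sub_eq_zero.2 h3
  · intro k w W X hW hX
    -- Contracting with `V` amounts to evaluating `w` on the fields `X` with `V` placed in front, so
    -- smoothness of `w` applies directly.
    let Y : Fin (k + 1) → ∀ x : S, TangentSpace (𝓡 2) x := Fin.cons V X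
    have hY : ∀ i, IsSmoothFieldOn (Y i) (U₁ ∩ W) := by
      refine Fin.cases ?_ fun i => ?_
      · exact hV.mono Set.inter_subset_left
      · exact (hX i).mono Set.inter_subset_right
    have hproj : ContMDiffOn 𝓘(ℝ, F) (𝓡 2) ∞ B.bundle.proj (B.bundle.proj ⁻¹' (U ∩ W)) :=
      B.bundle.contMDiff_proj.contMDiffOn
    have hw := (w.2 (U₁ ∩ W) Y (hU₁.inter hW) hY).comp (hs.mono Set.inter_subset_left)
      (hmaps (U₁ ∩ W))
    have h1 := hw.comp hproj fun p hp => ⟨hp.1.1.1, hp.1.1.2, hp.2⟩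
    have h2 := hLT.comp hproj fun p hp => hp.1
    have h3 := (contMDiff_AdCLM (E := E) (G := G)).comp_contMDiffOn
      ((lieGroup_real (E := E) (G := G)).contMDiff_inv.of_le le_top |>.comp_contMDiffOn
        (ht.mono fun p (hp : B.bundle.proj p ∈ U ∩ W) => hp.1.1.1))
    refine (h3.clm_apply (h2.clm_apply h1)).congr fun p hp => ?_
    have e1 : (w.1.contract V op (B.bundle.proj p) fun i => X i (B.bundle.proj p)).1 ⟨p, rfl⟩ =
      AdCLM (t p)⁻¹ (L (T (B.bundle.proj p)) ((w.1 (B.bundle.proj p)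
        (Matrix.vecCons (V (B.bundle.proj p)) fun i => X i (B.bundle.proj p))).1
          ⟨s (B.bundle.proj p), hps _ hp.1.1.1⟩)) := hop _ hp.1.1.1 _ _
    refine e1.trans ?_
    have e2 : (Matrix.vecCons (V (B.bundle.proj p)) fun i => X i (B.bundle.proj p)) =
        fun i => Y i (B.bundle.proj p) := by
      funext i
      refine Fin.cases rfl (fun i => rfl) i
    rw [e2, PrincipalBundle.PreForm.eval_fiber]
    rfl

end FockBundle

/-! ### Alternating forms on a plane. -/

section Alternating

open Module

variable {V W : Type*} [AddCommGroup V] [Module ℝ V] [AddCommGroup W] [Module ℝ W]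

theorem alternatingMap_eq_zero_of_finrank_lt [FiniteDimensional ℝ V] {k : ℕ}
    (f : V [⋀^Fin k]→ₗ[ℝ] W) (hk : finrank ℝ V < k) : f = 0 := by
  refine AlternatingMap.ext fun v => f.map_linearDependent v fun h => ?_
  have := h.fintype_card_le_finrank
  rw [Fintype.card_fin] at this
  omega

/-- Complete `u` to a basis: a 2-form on a plane is determined by its value on that one pair. -/
theorem alternatingMap_two_ext (hV : finrank ℝ V = 2) {u : V} (hu : u ≠ 0)
    {f g : V [⋀^Fin 2]→ₗ[ℝ] W} (h : ∀ w, f ![u, w] = g ![u, w]) : f = g := by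
  obtain ⟨w, hw⟩ := exists_linearIndependent_pair_of_one_lt_finrank (R := ℝ) (by omega) hu
  let b := basisOfLinearIndependentOfCardEqFinrank hw (by rw [hV, Fintype.card_fin])
  have hb : ⇑b = ![u, w] := coe_basisOfLinearIndependentOfCardEqFinrank hw _
  have hs : ∀ (q : V [⋀^Fin 2]→ₗ[ℝ] W) (x y : V), q ![x, y] = -q ![y, x] := fun q x y => by
    have := q.map_swap ![y, x] (i := 0) (j := 1) (by decide)
    rw [← this]
    congr 1
    funext i
    fin_cases i <;> simp
  refine b.ext_alternating fun v hv => ?_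
  have e : (fun i => b (v i)) = ![b (v 0), b (v 1)] := by
    funext i
    fin_cases i <;> rfl
  have h01 : v 0 ≠ v 1 := fun h => absurd (hv h) (by decide)
  rw [e, hb]
  rcases Fin.exists_fin_two.1 ⟨v 0, rfl⟩ with h0 | h0 <;>
    rcases Fin.exists_fin_two.1 ⟨v 1, rfl⟩ with h1 | h1
  · exact absurd (h0.trans h1.symm) h01
  · rw [h0, h1]
    exact h w
  · rw [h0, h1, hs f, hs g]
    exact congrArg Neg.neg (h w)
  · exact absurd (h0.trans h1.symm) h01

end Alternating

/-! ### Gluing by a partition of unity and vanishing of invariant cohomology. -/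

namespace FockBundle

variable {E G F S P : Type*}
  [NormedAddCommGroup E] [NormedSpace ℂ E] [FiniteDimensional ℂ E] [CompleteSpace E]
  [TopologicalSpace G] [ChartedSpace E G] [Group G] [LieGroup 𝓘(ℂ, E) ω G]
  [TopologicalSpace S] [ChartedSpace Plane S] [IsManifold (𝓡 2) ∞ S]
  [NormedAddCommGroup F] [NormedSpace ℝ F] [TopologicalSpace P] [ChartedSpace F P]
  {R : RealForms E G} {B : FockBundle E G F S P R}

/-- A homotopy operator over `U`, cut off by a function with support in `U`. -/
def LocalHomotopy.cutoff {U : Set S} (h : B.LocalHomotopy U) (hU : IsOpen U) {φ : S → ℝ}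
    (hφ : ContMDiff (𝓡 2) 𝓘(ℝ, ℝ) ∞ φ) (hφU : tsupport φ ⊆ U) {k : ℕ}
    (w : B.bundle.AdjForm (k + 1)) : B.bundle.AdjForm k :=
  ⟨fun x => (φ x : ℂ) • w.1.contract h.V h.op x, fun W X hW hX p hp => by
    have hpc := B.bundle.contMDiff_proj.continuous
    by_cases hpU : B.bundle.proj p ∈ U
    · have h1 := (h.smooth k w W X hW hX).contMDiffAt
        (((hU.inter hW).preimage hpc).mem_nhds ⟨hpU, hp⟩)
      have h2 := (hφ.comp B.bundle.contMDiff_proj).contMDiffAt (x := p)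
      exact (h2.smul h1).contMDiffWithinAt
    -- Outside `U` nothing is known about the homotopy operator, but the closed support of `φ` lies
    -- in `U`, so the product vanishes near `p`.
    · have h1 : ∀ᶠ q in nhds p, φ (B.bundle.proj q) = 0 := by
        have h2 : (tsupport φ)ᶜ ∈ nhds (B.bundle.proj p) :=
          (isClosed_tsupport φ).isOpen_compl.mem_nhds fun h => hpU (hφU h)
        filter_upwards [hpc.continuousAt h2] with q hq
        exact image_eq_zero_of_notMem_tsupport hq
      refine ((contMDiffAt_const (c := (0 : E))).congr_of_eventuallyEq ?_).contMDiffWithinAt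
      filter_upwards [h1] with q hq
      change ((φ (B.bundle.proj q) : ℂ) • (_ : E)) = 0
      exact smul_eq_zero_of_left (by rw [hq, Complex.ofReal_zero]) _⟩

omit [IsManifold (𝓡 2) ∞ S] in
theorem finrank_tangentSpace (x : S) : Module.finrank ℝ (TangentSpace (𝓡 2) x) = 2 :=
  finrank_euclideanSpace_fin (𝕜 := ℝ) (n := 2)

theorem adjForm_eq_zero_of_two_lt {k : ℕ} (hk : 2 < k) (w : B.bundle.AdjForm k) : w = 0 := by
  refine Subtype.ext (funext fun x => ?_)
  have : FiniteDimensional ℝ (TangentSpace (𝓡 2) x) := inferInstanceAs (FiniteDimensional ℝ Plane)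
  exact alternatingMap_eq_zero_of_finrank_lt (w.1 x) (by rwa [finrank_tangentSpace])

variable [LieAlgebra.IsSimple ℂ (LieAlg E G)]

theorem LocalHomotopy.lie_op_of_adj_eq {U : Set S} (h : B.LocalHomotopy U) {x : S} (hx : x ∈ U)
    {f : B.bundle.AdjFiber x} (hf : B.sigma.adj x f = f) :
    ⁅B.field x (h.V x), h.op x f⁆ = f :=
  h.lie_op x hx f (exists_lie_field_apply_eq (h.ne_zero x hx) hf)

/-- The contraction solves the equation in the direction `V` by construction. The cocycle condition
on the pair `(V, v)` is exactly the compatibility needed to pass to every other direction. -/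
theorem LocalHomotopy.wedgeBracket_contract_one {U : Set S} (h : B.LocalHomotopy U) {x : S}
    (hx : x ∈ U) {w : B.bundle.AdjForm 1} (hw : B.sigma.onForms 1 w = w)
    (hc : adForm B.Phi 1 w = 0) :
    B.Phi.1.wedgeBracket (w.1.contract h.V h.op) x = w.1 x := by
  have hinv : ∀ v, B.sigma.adj x (w.1 x v) = w.1 x v := fun v =>
    congrArg (fun w : B.bundle.AdjForm 1 => w.1 x v) hw
  refine AlternatingMap.ext fun v => ?_
  have e : (fun _ => v 0) = v := by
    funext i
    rw [Subsingleton.elim (α := Fin 1) i 0]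
  have e' : (fun _ => h.V x) =
      Matrix.vecCons (h.V x) (Fin.elim0 : Fin 0 → TangentSpace (𝓡 2) x) := by
    funext i
    rw [Subsingleton.elim (α := Fin 1) i 0]
    rfl
  refine (B.wedgeBracket_zero_apply _ x v).trans ?_
  rw [PrincipalBundle.PreForm.contract_apply, ← e']
  refine lie_field_eq_of_lie_field_eq (h.ne_zero x hx) (hinv _) (hinv v) ?_
    (h.lie_op_of_adj_eq hx (hinv _))
  have h1 := congrArg (fun w : B.bundle.AdjForm 2 => w.1 x ![h.V x, v 0]) hc
  have h2 := (B.wedgeBracket_one_apply w.1 x ![h.V x, v 0]).symm.trans h1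
  have h3 := sub_eq_zero.1 h2
  rw [← e]
  exact h3

/-- It suffices to compare values on pairs `(V, u)`. There the second term of the bracket involves
`w(V, V) = 0`, and the first is the equation solved by the homotopy operator. -/
theorem LocalHomotopy.wedgeBracket_contract_two {U : Set S} (h : B.LocalHomotopy U) {x : S}
    (hx : x ∈ U) {w : B.bundle.AdjForm 2} (hw : B.sigma.onForms 2 w = w) :
    B.Phi.1.wedgeBracket (w.1.contract h.V h.op) x = w.1 x := by
  have hinv : ∀ v, B.sigma.adj x (w.1 x v) = w.1 x v := fun v =>
    congrArg (fun w : B.bundle.AdjForm 2 => w.1 x v) hw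
  refine alternatingMap_two_ext (finrank_tangentSpace x) (h.ne_zero x hx) fun u => ?_
  have e : ∀ u : TangentSpace (𝓡 2) x,
      Matrix.vecCons (h.V x) (fun _ : Fin 1 => u) = ![h.V x, u] := by
    intro u
    funext i
    fin_cases i <;> rfl
  have h0 : w.1 x ![h.V x, h.V x] = 0 :=
    (w.1 x).map_eq_zero_of_eq _ (i := 0) (j := 1) rfl (by decide)
  refine (B.wedgeBracket_one_apply _ x ![h.V x, u]).trans ?_
  simp only [PrincipalBundle.PreForm.contract_apply, Matrix.cons_val_zero, Matrix.cons_val_one, e]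
  rw [h0, map_zero, lie_zero, sub_zero, h.lie_op_of_adj_eq hx (hinv _)]

variable [CompactSpace S] [T2Space S]

omit [LieAlgebra.IsSimple ℂ (LieAlg E G)] in
/-- A form that admits local homotopies is exact, by a partition of unity. -/
theorem exists_adForm_eq {k : ℕ} {w : B.bundle.AdjForm (k + 1)}
    (hw : ∀ (U : Set S) (h : B.LocalHomotopy U), ∀ x ∈ U,
      B.Phi.1.wedgeBracket (w.1.contract h.V h.op) x = w.1 x) :
    ∃ η : B.bundle.AdjForm k, adForm B.Phi k η = w := by
  choose U hU hxU hh using B.exists_localHomotopy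
  let h : ∀ x, B.LocalHomotopy (U x) := fun x => (hh x).some
  obtain ⟨t, ht⟩ := isCompact_univ.elim_finite_subcover U hU fun x _ =>
    Set.mem_iUnion.2 ⟨x, hxU x⟩
  obtain ⟨φ, hφ⟩ := SmoothPartitionOfUnity.exists_isSubordinate (𝓡 2) (isClosed_univ (X := S))
    (fun i : t => U i) (fun i => hU i) fun x hx => by
      obtain ⟨i, hi, hxi⟩ := Set.mem_iUnion₂.1 (ht hx)
      exact Set.mem_iUnion.2 ⟨⟨i, hi⟩, hxi⟩
  let η : t → B.bundle.AdjForm k := fun i => (h i).cutoff (hU i) (φ i).contMDiff (hφ i) w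
  refine ⟨∑ i, η i, ?_⟩
  -- The differential is linear over functions, so the cutoff passes through it with no derivative
  -- term; summing over the partition of unity then gives `w`.
  have key : ∀ i x, (adForm B.Phi k (η i)).1 x = (φ i x : ℂ) • w.1 x := by
    intro i x
    have h1 : (adForm B.Phi k (η i)).1 x =
        (φ i x : ℂ) • B.Phi.1.wedgeBracket (w.1.contract (h i).V (h i).op) x := by
      refine AlternatingMap.ext fun v => ?_
      refine (PrincipalBundle.PreForm.wedgeBracket_apply B.Phi.1 (η i).1 x v).trans ?_
      rw [AlternatingMap.smul_apply, PrincipalBundle.PreForm.wedgeBracket_apply, Finset.smul_sum]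
      refine Finset.sum_congr rfl fun j _ => ?_
      rw [smul_comm (φ i x : ℂ)]
      exact congrArg (fun z => (-1 : ℤ) ^ (j : ℕ) • z) (lie_smul (φ i x : ℂ) _ _)
    rw [h1]
    by_cases hx : x ∈ U i
    · rw [hw _ (h i) x hx]
    · rw [image_eq_zero_of_notMem_tsupport fun hx' => hx (hφ i hx'), Complex.ofReal_zero,
        zero_smul, zero_smul]
  have hsum : ∀ x, ∑ i, φ i x = 1 := fun x => by
    rw [← finsum_eq_sum_of_fintype]
    exact φ.sum_eq_one (Set.mem_univ x)
  refine Subtype.ext (funext fun x => ?_)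
  let ev : B.bundle.AdjForm (k + 1) →+
      (TangentSpace (𝓡 2) x [⋀^Fin (k + 1)]→ₗ[ℝ] B.bundle.AdjFiber x) :=
    { toFun := fun w => w.1 x, map_zero' := rfl, map_add' := fun _ _ => rfl }
  change ev (adForm B.Phi k (∑ i, η i)) = _
  rw [map_sum, map_sum]
  refine (Finset.sum_congr rfl fun i _ => key i x).trans ?_
  rw [← Finset.sum_smul, ← Complex.ofReal_sum, hsum, Complex.ofReal_one, one_smul]

theorem mem_coboundaries_of_invariant (k : ℕ) {w : B.bundle.AdjForm k}
    (hw : B.sigma.onForms k w = w) (hc : adForm B.Phi k w = 0) : w ∈ B.coboundaries k := by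
  match k with
  | 0 =>
    refine Subtype.ext (funext fun x => AlternatingMap.ext fun u => ?_)
    obtain ⟨v, hv⟩ : ∃ v : TangentSpace (𝓡 2) x, v ≠ 0 := by
      have : Nontrivial (TangentSpace (𝓡 2) x) :=
        Module.nontrivial_of_finrank_pos (R := ℝ) (by rw [finrank_tangentSpace]; norm_num)
      exact exists_ne 0
    refine eq_zero_of_lie_field_eq_zero hv
      (congrArg (fun w : B.bundle.AdjForm 0 => w.1 x u) hw) ?_
    have h1 := congrArg (fun w : B.bundle.AdjForm 1 => w.1 x fun _ => v) hc
    rw [Subsingleton.elim u Fin.elim0]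
    exact (B.wedgeBracket_zero_apply w.1 x fun _ => v).symm.trans h1
  | 1 => exact exists_adForm_eq fun U h x hx => h.wedgeBracket_contract_one hx hw hc
  | 2 => exact exists_adForm_eq fun U h x hx => h.wedgeBracket_contract_two hx hw
  | k + 3 =>
    rw [adjForm_eq_zero_of_two_lt (by omega) w]
    exact Submodule.zero_mem _

/-- For a representing cocycle `w`, the cocycle `σ w + w` is invariant, hence a coboundary. -/
theorem sigmaCohomology_eq_neg (k : ℕ) (c : B.Cohomology k) : B.sigmaCohomology k c = -c := by
  obtain ⟨w, rfl⟩ := Submodule.Quotient.mk_surjective _ c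
  rw [eq_neg_iff_add_eq_zero]
  change Submodule.Quotient.mk (B.sigmaCocycles k w) + Submodule.Quotient.mk w = _
  rw [← Submodule.Quotient.mk_add, Submodule.Quotient.mk_eq_zero]
  refine mem_coboundaries_of_invariant k ?_ (B.sigmaCocycles k w + w).2
  have hss : B.sigma.onForms k (B.sigma.onForms k w.1) = w.1 :=
    Subtype.ext (funext fun x => AlternatingMap.ext fun v => B.sigma.adj_adj x _)
  change B.sigma.onForms k (B.sigma.onForms k w.1 + w.1) = B.sigma.onForms k w.1 + w.1
  rw [map_add, hss, add_comm]

end FockBundle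

end Fock

end

theorem proposition3p7 {E G F S P : Type*}
    [NormedAddCommGroup E] [NormedSpace ℂ E] [FiniteDimensional ℂ E] [CompleteSpace E]
    [TopologicalSpace G] [ChartedSpace E G] [Group G] [LieGroup 𝓘(ℂ, E) ω G]
    [ConnectedSpace G] [LieAlgebra.IsSimple ℂ (Fock.LieAlg E G)]
    [TopologicalSpace S] [ChartedSpace Fock.Plane S] [IsManifold (𝓡 2) ∞ S]
    [CompactSpace S] [T2Space S]
    [NormedAddCommGroup F] [NormedSpace ℝ F] [TopologicalSpace P] [ChartedSpace F P]
    [IsManifold 𝓘(ℝ, F) ∞ P]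
    (R : Fock.RealForms E G) (B : Fock.FockBundle E G F S P R) :
    (∀ η : B.bundle.AdjForm 0, B.IsInfinitesimalAutomorphism η → η = 0) ∧
      ∀ k : ℕ, B.invariantCohomology k = ⊥ ∧
        (∀ c : B.Cohomology k, B.sigmaCohomology k c = c → c = 0) ∧
        ∀ c : B.Cohomology k, B.sigmaCohomology k c = -c := by
  -- The coboundaries in degree 0 form the zero subspace, so membership already says `η = 0`.
  refine ⟨fun η hη => Fock.FockBundle.mem_coboundaries_of_invariant 0 hη.2 hη.1,
    fun k => ⟨?_, fun c hc => ?_, Fock.FockBundle.sigmaCohomology_eq_neg k⟩⟩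
  · rw [eq_bot_iff]
    rintro _ ⟨w, hw, rfl⟩
    have hw : B.sigmaCocycles k w = w := hw
    refine (Submodule.Quotient.mk_eq_zero _).2 ?_
    exact Fock.FockBundle.mem_coboundaries_of_invariant k (congrArg Subtype.val hw) w.2
  -- A fixed class satisfies `c = σ c = -c`.
  · have h2 : (2 : ℂ) • c = 0 := by
      rw [two_smul]
      nth_rewrite 1 [← hc]
      rw [Fock.FockBundle.sigmaCohomology_eq_neg, neg_add_cancel]
    exact (smul_eq_zero.1 h2).resolve_left two_ne_zero
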